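/- **Language.** Fix a finite set $Ag$ of agents and countably infinite sets of proof variables $x$, proof constants $c$ and propositional variables $p$. Proof polynomials: $t ::= x \mid c \mid s+t \mid s\times t \mid {!t}$. Formulas ($Form$): $A ::= p \mid A\wedge B \mid \neg A \mid [j]A \mid \Box A \mid t{:}A \mid KA \mid Et$ ($j\in Ag$). The other connectives, $\bot$ (a fixed contradiction) and $\Diamond=\neg\Box\neg$ are abbreviations. **Models.** A *jstit model* $\mathcal M=\langle Tree,\unlhd,Choice,Act,R,R_e,\mathcal E,V\rangle$ consists of a non-empty partially ordered set $(Tree,\unlhd)$ of moments; its *histories* are the maximal $\unlhd$-chains, and $H_m$ is the set of histories containing $m$; for each moment $m$ and agent $j$ a partition $Choice^m_j$ of $H_m$, with $Choice^m_j(h)$ the cell of $h$; sets $Act(m,h)$ of proof polynomials for $h\in H_m$; preorders $R\subseteq R_e$ on $Tree$; sets $\mathcal E(m,t)$ of formulas; and sets $V(p)$ of pairs $(m,h)$ with $h\in H_m$. The following is required: 1. any two moments have a common $\unlhd$-lower bound; 2. if $m_1,m_2\unlhd m$ then $m_1\unlhd m_2$ or $m_2\unlhd m_1$; 3. if $m\lhd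 m'$ and $m'\in h\cap h'$ then $Choice^m_j(h)=Choice^m_j(h')$; 4. if $f(j)\in Choice^m_j$ for all $j\in Ag$ then $\bigcap_{j\in Ag} f(j)\ne\emptyset$; 5. $R_e(m,m')$ implies $\mathcal E(m,t)\subseteq\mathcal E(m',t)$; 6. if $A\to B\in\mathcal E(m,s)$ and $A\in\mathcal E(m,t)$ then $B\in\mathcal E(m,s\times t)$; $\mathcal E(m,s)\cup\mathcal E(m,t)\subseteq\mathcal E(m,s+t)$; if $A\in\mathcal E(m,t)$ then $t{:}A\in\mathcal E(m,!t)$; 7. if $m'\lhd m$ and $h\in H_m$ then $Act(m',h)\subseteq Act(m,h)$; 8. $\bigcap_{h\in H_m}Act(m,h)\subseteq\bigcup_{m'\lhd m,\,h\in H_m}Act(m',h)$; 9. if $h,h'\in H_m$ share some $m'\rhd m$ then $Act(m,h)=Act(m,h')$; 10. $\unlhd\ \subseteq R$; 11. $R_e(m,m')$ implies $\bigcap_{h\in H_m}Act(m,h)\subseteq\bigcap_{h'\in H_{m'}}Act(m',h')$. The model is *unirelational* if also $R_e\subseteq R$. Satisfaction at $(m,h)$, $h\in H_m$: $p$ holds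 iff $(m,h)\in V(p)$; Booleans as usual; $[j]A$ iff $A$ holds at $(m,h')$ for all $h'\in Choice^m_j(h)$; $\Box A$ iff $A$ holds at $(m,h')$ for all $h'\in H_m$; $KA$ iff $A$ holds at all $(m',h')$ with $R(m,m')$, $h'\in H_{m'}$; $t{:}A$ iff $A\in\mathcal E(m,t)$ and $A$ holds at all $(m',h')$ with $R_e(m,m')$, $h'\in H_{m'}$; $Et$ iff $t\in Act(m,h)$. A set of formulas is *satisfiable in* a model if all its members hold at one common pair $(m,h)$; a formula is *valid* over a class of models if it holds at every pair of every model in the class. **Axioms.** (A0) all instances of classical tautologies; (A1) the S5 axioms for $\Box$ and each $[j]$; (A2) $\Box A\to[j]A$; (A3) $(\Diamond[j_1]A_1\wedge\dots\wedge\Diamond[j_n]A_n)\to\Diamond([j_1]A_1\wedge\dots\wedge[j_n]A_n)$ for $n\geq 1$ pairwise different agents; (A4) $s{:}(A\to B)\to(t{:}A\to(s\times t){:}B)$; (A5) $t{:}A\to({!t}{:}(t{:}A)\wedge KA)$; (A6) $(s{:}A\vee t{:}A)\to(s+t){:}A$; (A7) the S4 axioms for $K$; (A8) $KA\to\Box K\Box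 A$; (A9) $\Box Et\to K\Box Et$. A *constant specification* is a set $\mathcal{CS}$ of formulas of the form $c_n{:}\dots c_1{:}A$, with $n\ge1$, $c_i$ proof constants and $A$ an instance of (A0)–(A9), that contains $c_n{:}\dots c_1{:}A$ whenever it contains $c_{n+1}{:}c_n{:}\dots c_1{:}A$. The system $\Sigma_{\mathcal{CS}}$ has the axioms (A0)–(A9) and the rules: (R1) from $A$ and $A\to B$ infer $B$; (R2) from $A$ infer $KA$; (R4) from $KA\to(\neg\Box Et_1\vee\dots\vee\neg\Box Et_n)$ infer $KA\to(\neg Et_1\vee\dots\vee\neg Et_n)$ ($n\geq 1$); ($R_{\mathcal{CS}}$) infer any member of $\mathcal{CS}$. A set $\Gamma\subseteq Form$ is *inconsistent relative to* $\Sigma_{\mathcal{CS}}$ if $(A_1\wedge\dots\wedge A_n)\to\bot$ is provable in $\Sigma_{\mathcal{CS}}$ for some $A_1,\dots,A_n\in\Gamma$, and *consistent* otherwise. **Theorem.** Let $\mathcal{CS}$ be a constant specification and $\Gamma\subseteq Form$. Then the following are equivalent: (i) $\Gamma$ is consistent relative to $\Sigma_{\mathcal{CS}}$; (ii) $\Gamma$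 is satisfiable in a jstit model with $\{A\mid c{:}A\in\mathcal{CS}\}\subseteq\mathcal E(m,c)$ for all proof constants $c$ and all moments $m$; (iii) $\Gamma$ is satisfiable in a unirelational jstit model with the same property. In particular, for every formula $A$: $A$ is provable in $\Sigma_\emptyset$ iff $A$ is valid over all jstit models, iff $A$ is valid over all unirelational jstit models. -/

import Mathlib

universe u

namespace JStit

/-! ### Language -/

/-- Proof polynomials. Both the proof variables and the proof constants are indexed by `ℕ`. -/
inductive Pol : Type
  | var (x : ℕ) : Pol
  | const (c : ℕ) : Pol
  | sum (s t : Pol) : Pol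
  | app (s t : Pol) : Pol
  | bang (t : Pol) : Pol

/-- Formulas over a set `Ag` of agents:
`p`, `A ∧ B`, `¬A`, `[j]A`, `□A`, `t:A`, `KA`, `Et`. -/
inductive Form (Ag : Type u) : Type u
  | atom (p : ℕ) : Form Ag
  | and (A B : Form Ag) : Form Ag
  | neg (A : Form Ag) : Form Ag
  | stit (j : Ag) (A : Form Ag) : Form Ag
  | box (A : Form Ag) : Form Ag
  | just (t : Pol) (A : Form Ag) : Form Ag
  | know (A : Form Ag) : Form Ag
  | pres (t : Pol) : Form Ag

namespace Form

variable {Ag : Type u}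

/-- `A → B`. -/
def imp (A B : Form Ag) : Form Ag := neg (and A (neg B))

/-- `A ∨ B`. -/
def or (A B : Form Ag) : Form Ag := neg (and (neg A) (neg B))

/-- `⊥`, as a fixed propositional contradiction. -/
def bot : Form Ag := and (atom 0) (neg (atom 0))

/-- `◇A`, the dual of `□A`. -/
def dia (A : Form Ag) : Form Ag := neg (box (neg A))

/-- Conjunction of the non-empty list `A :: L`. -/
def conj (A : Form Ag) : List (Form Ag) → Form Ag
  | [] => A
  | B :: L => and A (conj B L)

/-- Disjunction of the non-empty list `A :: L`. -/
def disj (A : Form Ag) : List (Form Ag) → Form Ag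
  | [] => A
  | B :: L => or A (disj B L)

/-- `constPrefix [cₙ, …, c₁] A` is the formula `cₙ:…:c₁:A`. -/
def constPrefix : List ℕ → Form Ag → Form Ag
  | [], A => A
  | c :: l, A => just (Pol.const c) (constPrefix l A)

/-- Classical evaluation that treats every formula that is neither a conjunction nor a negation
as a propositional atom, with truth value given by `v`. -/
def boolEval (v : Form Ag → Prop) : Form Ag → Prop
  | and A B => boolEval v A ∧ boolEval v B
  | neg A => ¬ boolEval v A
  | A => v A

/-- `A` is a substitution instance of a classical propositional tautology. -/
def IsTautology (A : Form Ag) : Prop := ∀ v : Form Ag → Prop, boolEval v A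

end Form

open Form

/-! ### Axiomatic systems -/

/-- The `S4` axioms for a modality `N`. -/
inductive S4Axiom {Ag : Type u} (N : Form Ag → Form Ag) : Form Ag → Prop
  | axK (A B : Form Ag) : S4Axiom N (imp (N (imp A B)) (imp (N A) (N B)))
  | axT (A : Form Ag) : S4Axiom N (imp (N A) A)
  | ax4 (A : Form Ag) : S4Axiom N (imp (N A) (N (N A)))

/-- The `S5` axioms for a modality `N` (both of the usual axioms `B` and `5` are listed). -/
inductive S5Axiom {Ag : Type u} (N : Form Ag → Form Ag) : Form Ag → Prop
  | ofS4 {A : Form Ag} (h : S4Axiom N A) : S5Axiom N A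
  | axB (A : Form Ag) : S5Axiom N (imp A (N (neg (N (neg A)))))
  | ax5 (A : Form Ag) : S5Axiom N (imp (neg (N A)) (N (neg (N A))))

/-- Instances of the axiom schemes. In `a3` the agents are pairwise different. -/
inductive IsAxiom {Ag : Type u} : Form Ag → Prop
  | a0 {A : Form Ag} (h : IsTautology A) : IsAxiom A
  | a1_box {A : Form Ag} (h : S5Axiom box A) : IsAxiom A
  | a1_stit (j : Ag) {A : Form Ag} (h : S5Axiom (stit j) A) : IsAxiom A
  | a2 (j : Ag) (A : Form Ag) : IsAxiom (imp (box A) (stit j A))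
  | a3 (p : Ag × Form Ag) (L : List (Ag × Form Ag))
      (h : ((p :: L).map Prod.fst).Nodup) :
      IsAxiom (imp
        (conj (dia (stit p.1 p.2)) (L.map fun q => dia (stit q.1 q.2)))
        (dia (conj (stit p.1 p.2) (L.map fun q => stit q.1 q.2))))
  | a4 (s t : Pol) (A B : Form Ag) :
      IsAxiom (imp (just s (imp A B)) (imp (just t A) (just (Pol.app s t) B)))
  | a5 (t : Pol) (A : Form Ag) :
      IsAxiom (imp (just t A) (Form.and (just (Pol.bang t) (just t A)) (know A)))
  | a6 (s t : Pol) (A : Form Ag) :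
      IsAxiom (imp (Form.or (just s A) (just t A)) (just (Pol.sum s t) A))
  | a7 {A : Form Ag} (h : S4Axiom know A) : IsAxiom A
  | a8 (A : Form Ag) : IsAxiom (imp (know A) (box (know (box A))))
  | a9 (t : Pol) : IsAxiom (imp (box (pres t)) (know (box (pres t))))

/-- Constant specifications: sets of formulas `cₙ:…:c₁:A` with `n ≥ 1` and `A` an axiom instance,
such that `cₙ:…:c₁:A` belongs to the set whenever `cₙ₊₁:cₙ:…:c₁:A` does (`n ≥ 1`). -/
structure IsConstSpec {Ag : Type u} (CS : Set (Form Ag)) : Prop where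
  form : ∀ B ∈ CS, ∃ (l : List ℕ) (A : Form Ag), l ≠ [] ∧ IsAxiom A ∧ B = constPrefix l A
  tail : ∀ (c : ℕ) (l : List ℕ) (A : Form Ag), l ≠ [] → IsAxiom A →
    constPrefix (c :: l) A ∈ CS → constPrefix l A ∈ CS

/-- Provability: modus ponens, necessitation for `K`, the rule that passes from
`KA → (¬□Et₁ ∨ … ∨ ¬□Etₙ)` to `KA → (¬Et₁ ∨ … ∨ ¬Etₙ)`, and "infer any member of `CS`". -/
inductive Provable {Ag : Type u} (CS : Set (Form Ag)) : Form Ag → Prop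
  | ax {A : Form Ag} (h : IsAxiom A) : Provable CS A
  | r1 {A B : Form Ag} (h₁ : Provable CS A) (h₂ : Provable CS (imp A B)) : Provable CS B
  | r2 {A : Form Ag} (h : Provable CS A) : Provable CS (know A)
  | r4 {A : Form Ag} {t : Pol} {L : List Pol}
      (h : Provable CS (imp (know A)
        (disj (neg (box (pres t))) (L.map fun s => neg (box (pres s)))))) :
      Provable CS (imp (know A) (disj (neg (pres t)) (L.map fun s => neg (pres s))))
  | rcs {A : Form Ag} (h : A ∈ CS) : Provable CS A

/-- `Γ` is inconsistent if `(A₁ ∧ … ∧ Aₙ) → ⊥` is provable for some `A₁, …, Aₙ ∈ Γ`. -/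
def Inconsistent {Ag : Type u} (CS Γ : Set (Form Ag)) : Prop :=
  ∃ (A : Form Ag) (L : List (Form Ag)), A ∈ Γ ∧ (∀ B ∈ L, B ∈ Γ) ∧
    Provable CS (imp (conj A L) bot)

/-- `Γ` is consistent if it is not inconsistent. -/
def Consistent {Ag : Type u} (CS Γ : Set (Form Ag)) : Prop := ¬ Inconsistent CS Γ

/-! ### Semantics -/

/-- Histories: maximal chains of moments. -/
def Hist (T : Type u) [PartialOrder T] : Type u := {h : Set T // IsMaxChain (· ≤ ·) h}

/-- The set `H_m` of the histories that contain the moment `m`. -/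
def histThrough {T : Type u} [PartialOrder T] (m : T) : Set (Hist T) := {h | m ∈ h.1}

/-- Justification stit models. `Act` and `V` are total functions of a moment and a history;
only their values at pairs `(m, h)` with `h ∈ H_m` are ever used. -/
structure Model (Ag : Type u) where
  Tree : Type u
  [tree_nonempty : Nonempty Tree]
  [order : PartialOrder Tree]
  Choice : Tree → Ag → Set (Set (Hist Tree))
  Act : Tree → Hist Tree → Set Pol
  R : Tree → Tree → Prop
  Re : Tree → Tree → Prop
  Ev : Tree → Pol → Set (Form Ag)
  V : ℕ → Set (Tree × Hist Tree)
  /-- `Choice m j` is a partition of `H_m`. -/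
  choice_sub : ∀ m j, ∀ s ∈ Choice m j, s ⊆ histThrough m
  choice_nonempty : ∀ m j, ∀ s ∈ Choice m j, s.Nonempty
  choice_unique : ∀ m j, ∀ h ∈ histThrough m, ∃! s, s ∈ Choice m j ∧ h ∈ s
  /-- `R ⊆ Re` are preorders. -/
  R_refl : ∀ m, R m m
  R_trans : ∀ m₁ m₂ m₃, R m₁ m₂ → R m₂ m₃ → R m₁ m₃
  Re_refl : ∀ m, Re m m
  Re_trans : ∀ m₁ m₂ m₃, Re m₁ m₂ → Re m₂ m₃ → Re m₁ m₃
  R_sub_Re : ∀ m₁ m₂, R m₁ m₂ → Re m₁ m₂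
  historical_connection : ∀ m m₁ : Tree, ∃ m₂, m₂ ≤ m ∧ m₂ ≤ m₁
  no_backward_branching : ∀ m m₁ m₂ : Tree, m₁ ≤ m → m₂ ≤ m → m₁ ≤ m₂ ∨ m₂ ≤ m₁
  /-- Histories that are undivided at `m` lie in the same element of `Choice m j`. -/
  no_choice_undivided : ∀ (m m' : Tree) (j : Ag), ∀ h ∈ histThrough m, ∀ h' ∈ histThrough m,
    m < m' → m' ∈ h.1 → m' ∈ h'.1 → ∀ s ∈ Choice m j, h ∈ s ↔ h' ∈ s
  independence : ∀ (m : Tree) (f : Ag → Set (Hist Tree)), (∀ j, f j ∈ Choice m j) →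
    (⋂ j, f j).Nonempty
  evidence_mono : ∀ (t : Pol) (m m' : Tree), Re m m' → Ev m t ⊆ Ev m' t
  evidence_app : ∀ (m : Tree) (s t : Pol) (A B : Form Ag),
    imp A B ∈ Ev m s → A ∈ Ev m t → B ∈ Ev m (Pol.app s t)
  evidence_sum : ∀ (m : Tree) (s t : Pol), Ev m s ∪ Ev m t ⊆ Ev m (Pol.sum s t)
  evidence_bang : ∀ (m : Tree) (t : Pol) (A : Form Ag),
    A ∈ Ev m t → just t A ∈ Ev m (Pol.bang t)
  expansion : ∀ m m' : Tree, m' < m → ∀ h ∈ histThrough m, Act m' h ⊆ Act m h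
  no_new_proofs_guaranteed : ∀ m : Tree,
    (⋂ h ∈ histThrough m, Act m h) ⊆ ⋃ m' ∈ Set.Iio m, ⋃ h ∈ histThrough m, Act m' h
  new_proof_divides : ∀ m : Tree, ∀ h ∈ histThrough m, ∀ h' ∈ histThrough m,
    (∃ m', m < m' ∧ m' ∈ h.1 ∧ m' ∈ h'.1) → Act m h = Act m h'
  future_matters : ∀ m m' : Tree, m ≤ m' → R m m'
  transparency : ∀ m m' : Tree, Re m m' →
    (⋂ h ∈ histThrough m, Act m h) ⊆ ⋂ h' ∈ histThrough m', Act m' h'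

attribute [instance] Model.tree_nonempty Model.order

namespace Model

variable {Ag : Type u}

/-- Unirelational models. -/
def Unirelational (M : Model Ag) : Prop := ∀ m m', M.Re m m' → M.R m m'

/-- The element of the partition `Choice m j` that contains `h`. -/
def cell (M : Model Ag) (m : M.Tree) (j : Ag) (h : Hist M.Tree) : Set (Hist M.Tree) :=
  {h' | ∃ s ∈ M.Choice m j, h ∈ s ∧ h' ∈ s}

/-- The satisfaction relation; meaningful for `h ∈ H_m`. -/
def Sat (M : Model Ag) : M.Tree → Hist M.Tree → Form Ag → Prop
  | m, h, atom p => (m, h) ∈ M.V p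
  | m, h, Form.and A B => M.Sat m h A ∧ M.Sat m h B
  | m, h, neg A => ¬ M.Sat m h A
  | m, h, stit j A => ∀ h' ∈ M.cell m j h, M.Sat m h' A
  | m, _, box A => ∀ h' ∈ histThrough m, M.Sat m h' A
  | m, _, just t A => A ∈ M.Ev m t ∧ ∀ m', M.Re m m' → ∀ h' ∈ histThrough m', M.Sat m' h' A
  | m, _, know A => ∀ m', M.R m m' → ∀ h' ∈ histThrough m', M.Sat m' h' A
  | m, h, pres t => t ∈ M.Act m h

/-- `Γ` is satisfiable in `M`: all its members hold together at some moment-history pair. -/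
def Satisfies (M : Model Ag) (Γ : Set (Form Ag)) : Prop :=
  ∃ m : M.Tree, ∃ h ∈ histThrough m, ∀ A ∈ Γ, M.Sat m h A

/-- `A` holds at all moment-history pairs of `M`. -/
def Validates (M : Model Ag) (A : Form Ag) : Prop :=
  ∀ m : M.Tree, ∀ h ∈ histThrough m, M.Sat m h A

/-- `{A | c:A ∈ CS} ⊆ Ev m c` for every proof constant `c` and every moment `m`. -/
def RespectsCS (M : Model Ag) (CS : Set (Form Ag)) : Prop :=
  ∀ (c : ℕ) (m : M.Tree), {A | just (Pol.const c) A ∈ CS} ⊆ M.Ev m (Pol.const c)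

end Model

end JStit

/-!
Soundness is an induction on derivations. The only delicate rule is `(R4)`: if the proofs
`t₁, …, tₙ` are presented at `(m, h)`, then at any later moment of `h` they are presented on all
histories, and if `h` has no later moment, then it is the only history through `m`
(`Model.exists_settled`). So a counterexample to the conclusion of `(R4)` moves to a counterexample
to its premise.

For completeness, a single unirelational model satisfies every consistent set. Its worlds are the
maximal consistent sets, and a moment `m` carries a world `rep m`, or rather the class of the worlds
that contain the same formulas `□A`. A history through `m` picks a world `lab m h` of this class by
the direction in which it leaves `m`, and every world of the class is picked. Choices are then read
off from the formulas `[j]A` of the labels (independence of agents is `World.exists_acc_stit`, from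
axiom `(A3)`), knowledge from the formulas `KA`, evidence from the formulas `t:A`, and the presented
proofs from the formulas `Et`.

The order of moments has to reconcile two demands on proofs. A presented proof must be settled at
all later moments, and a settled proof must have been presented before. The rule `(R4)` shows that
the knowledge of a world `Γ` is consistent with the settledness of all its presented proofs
(`World.consistent_settled`). By Zorn's lemma `Γ` then has a *mature* successor, in whose class
every presented proof is settled (`World.exists_mature`). A mature class can repeat itself forever,
and the time after a base moment is a copy of `ℤ`: as no moment comes first after the base moment,
every settled proof of the mature class was presented before, although it may be new compared to the
base moment. The proofs settled at a base moment itself are presented at an artificial root below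
all moments. The root accesses all moments but is accessed by none of the others, so it does not
interfere with the truth lemma; what it needs is that no proof is presented on all histories, which
holds as the theory of the one-point model contains no formula `□Et`.

Moments are initial segments of sequences of worlds over the linear order `Time`, so that the order
is backwards linear and a maximal chain determines its directions.
-/

namespace JStit

open Form

variable {Ag : Type u}

/-! ### Propositional reasoning -/

section Propositional

variable {CS : Set (Form Ag)}

theorem boolEval_imp (v : Form Ag → Prop) (A B : Form Ag) :
    boolEval v (imp A B) ↔ (boolEval v A → boolEval v B) := by
  simp [imp, boolEval]

theorem boolEval_or (v : Form Ag → Prop) (A B : Form Ag) :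
    boolEval v (Form.or A B) ↔ (boolEval v A ∨ boolEval v B) := by
  simp only [Form.or, boolEval]; tauto

theorem boolEval_neg (v : Form Ag → Prop) (A : Form Ag) :
    boolEval v (neg A) ↔ ¬ boolEval v A := Iff.rfl

theorem boolEval_and (v : Form Ag → Prop) (A B : Form Ag) :
    boolEval v (Form.and A B) ↔ (boolEval v A ∧ boolEval v B) := Iff.rfl

theorem boolEval_bot (v : Form Ag → Prop) : ¬ boolEval v bot := by
  simp [bot, boolEval]

theorem boolEval_conj (v : Form Ag → Prop) (A : Form Ag) (L : List (Form Ag)) :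
    boolEval v (conj A L) ↔ boolEval v A ∧ ∀ B ∈ L, boolEval v B := by
  induction L generalizing A with
  | nil => simp [conj]
  | cons B L ih => simp [conj, boolEval_and, ih]

theorem boolEval_disj (v : Form Ag → Prop) (A : Form Ag) (L : List (Form Ag)) :
    boolEval v (disj A L) ↔ boolEval v A ∨ ∃ B ∈ L, boolEval v B := by
  induction L generalizing A with
  | nil => simp [disj]
  | cons B L ih => simp [disj, boolEval_or, ih]

theorem boolEval_foldr_imp (v : Form Ag → Prop) (L : List (Form Ag)) (A : Form Ag) :
    boolEval v (L.foldr imp A) ↔ ((∀ B ∈ L, boolEval v B) → boolEval v A) := by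
  induction L with
  | nil => simp
  | cons B L ih => simp [boolEval_imp, ih]

theorem provable_of_foldr_imp {L : List (Form Ag)} {A : Form Ag}
    (hL : ∀ B ∈ L, Provable CS B) (h : Provable CS (L.foldr imp A)) : Provable CS A := by
  induction L with
  | nil => exact h
  | cons B L ih =>
    exact ih (fun C hC => hL C (by simp [hC])) (Provable.r1 (hL B (by simp)) h)

/-- Provability is closed under propositional consequence. -/
theorem provable_of_boolEval (L : List (Form Ag)) {A : Form Ag}
    (hL : ∀ B ∈ L, Provable CS B)
    (h : ∀ v, (∀ B ∈ L, boolEval v B) → boolEval v A) : Provable CS A :=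
  provable_of_foldr_imp hL
    (Provable.ax (IsAxiom.a0 fun v => (boolEval_foldr_imp v L A).2 (h v)))

/-- `A` follows in `Σ_CS` from finitely many members of `S`. The empty list of premises is allowed,
so that `Entails CS ∅` is provability. -/
def Entails (CS S : Set (Form Ag)) (A : Form Ag) : Prop :=
  ∃ L : List (Form Ag), (∀ B ∈ L, B ∈ S) ∧ Provable CS (L.foldr imp A)

theorem Entails.mono {S S' : Set (Form Ag)} {A : Form Ag} (hS : S ⊆ S')
    (h : Entails CS S A) : Entails CS S' A := by
  obtain ⟨L, hL, hA⟩ := h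
  exact ⟨L, fun B hB => hS (hL B hB), hA⟩

theorem Entails.of_provable {S : Set (Form Ag)} {A : Form Ag} (h : Provable CS A) :
    Entails CS S A := ⟨[], by simp, h⟩

theorem Entails.of_mem {S : Set (Form Ag)} {A : Form Ag} (h : A ∈ S) : Entails CS S A :=
  ⟨[A], by simpa using h, provable_of_boolEval [] (by simp) fun v _ => by simp [boolEval_imp]⟩

theorem Entails.of_boolEval {S : Set (Form Ag)} (L : List (Form Ag)) {A : Form Ag}
    (hL : ∀ B ∈ L, Entails CS S B)
    (h : ∀ v, (∀ B ∈ L, boolEval v B) → boolEval v A) : Entails CS S A := by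
  induction L generalizing A with
  | nil => exact .of_provable (provable_of_boolEval [] (by simp) h)
  | cons C L ih =>
    obtain ⟨L₁, hL₁, h₁⟩ := hL C (by simp)
    obtain ⟨L₂, hL₂, h₂⟩ := ih (A := imp C A) (fun B hB => hL B (by simp [hB])) (fun v hv => by
      rw [boolEval_imp]
      intro hC
      exact h v (by simpa using ⟨hC, hv⟩))
    refine ⟨L₁ ++ L₂, fun B hB => ?_, provable_of_boolEval [_, _] (by simpa using ⟨h₁, h₂⟩) ?_⟩
    · rcases List.mem_append.1 hB with hB | hB
      exacts [hL₁ B hB, hL₂ B hB]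
    · intro v hv
      simp only [List.mem_cons, List.not_mem_nil, or_false, forall_eq_or_imp, forall_eq,
        boolEval_foldr_imp, List.mem_append, boolEval_imp] at hv ⊢
      intro hB
      exact hv.2 (fun B h => hB B (.inr h)) (hv.1 fun B h => hB B (.inl h))

/-- The premises of a derivation from `P ∪ Q` that do not lie in `P` can be discharged. -/
theorem Entails.exists_discharge {P Q : Set (Form Ag)} {A : Form Ag}
    (h : Entails CS (P ∪ Q) A) :
    ∃ L : List (Form Ag), (∀ B ∈ L, B ∈ Q) ∧ Entails CS P (L.foldr imp A) := by
  classical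
  obtain ⟨L, hL, hA⟩ := h
  refine ⟨L.filter (· ∉ P), fun B hB => ?_, L.filter (· ∈ P), fun B hB => ?_,
    provable_of_boolEval [_] (by simpa using hA) fun v hv => ?_⟩
  · simp only [List.mem_filter, decide_eq_true_eq] at hB
    exact (hL B hB.1).resolve_left hB.2
  · simp only [List.mem_filter, decide_eq_true_eq] at hB
    exact hB.2
  · simp only [List.mem_cons, List.not_mem_nil, or_false, forall_eq, boolEval_foldr_imp,
      List.mem_filter, decide_eq_true_eq, and_imp] at hv ⊢
    intro h₁ h₂
    exact hv fun B hB => if hP : B ∈ P then h₁ B hB hP else h₂ B hB hP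

theorem Entails.imp_of_insert {S : Set (Form Ag)} {A B : Form Ag}
    (h : Entails CS (insert A S) B) : Entails CS S (imp A B) := by
  rw [Set.insert_eq, Set.union_comm] at h
  obtain ⟨L, hL, h⟩ := h.exists_discharge
  refine .of_boolEval [_] (by simpa using h) fun v hv => ?_
  simp only [List.mem_cons, List.not_mem_nil, or_false, forall_eq, boolEval_foldr_imp,
    boolEval_imp] at hv ⊢
  intro hA
  exact hv fun C hC => by rw [hL C hC]; exact hA

theorem not_provable_bot_of_not_entails {S : Set (Form Ag)} (h : ¬ Entails CS S bot) :
    ¬ Provable CS (bot : Form Ag) := fun h' => h (.of_provable h')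

theorem Inconsistent.entails {S : Set (Form Ag)} (h : Inconsistent CS S) :
    Entails CS S bot := by
  obtain ⟨A, L, hA, hL, h⟩ := h
  refine ⟨A :: L, by simpa using ⟨hA, hL⟩, provable_of_boolEval [_] (by simpa using h) ?_⟩
  intro v hv
  simpa [boolEval_imp, boolEval_conj, boolEval_foldr_imp] using hv

/-- The converse fails for `S = ∅` in an inconsistent system: `Inconsistent` asks for at least one
premise. -/
theorem Entails.inconsistent {S : Set (Form Ag)} (hbot : ¬ Provable CS (bot : Form Ag))
    (h : Entails CS S bot) : Inconsistent CS S := by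
  obtain ⟨L, hL, h⟩ := h
  cases L with
  | nil => exact absurd h hbot
  | cons A L =>
    refine ⟨A, L, hL A (by simp), fun B hB => hL B (by simp [hB]),
      provable_of_boolEval [_] (by simpa using h) fun v hv => ?_⟩
    simpa [boolEval_imp, boolEval_conj, boolEval_foldr_imp] using hv

end Propositional

/-! ### Maximal consistent sets -/

section MaximalConsistent

variable {CS : Set (Form Ag)}

/-- Every consistent `S` extends to a set that is maximal among the consistent sets between `S` and
`S ∪ Q`. -/
theorem exists_maximal_consistent {S : Set (Form Ag)} (Q : Set (Form Ag))
    (hS : ¬ Entails CS S bot) :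
    ∃ M, S ⊆ M ∧ M ⊆ S ∪ Q ∧ ¬ Entails CS M bot ∧
      ∀ A ∈ Q, ¬ Entails CS (insert A M) bot → A ∈ M := by
  obtain ⟨M, hSM, hM⟩ := zorn_subset_nonempty
    {M : Set (Form Ag) | M ⊆ S ∪ Q ∧ ¬ Entails CS M bot} (fun c hc hchain hne => by
      refine ⟨⋃₀ c, ⟨Set.sUnion_subset fun M hM => (hc hM).1, ?_⟩,
        fun M hM => Set.subset_sUnion_of_mem hM⟩
      rintro ⟨L, hL, h⟩
      obtain ⟨M, hMc, hLM⟩ : ∃ M ∈ c, ∀ B ∈ L, B ∈ M := by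
        clear h
        induction L with
        | nil => exact ⟨_, hne.choose_spec, by simp⟩
        | cons B L ih =>
          obtain ⟨M, hM, h₁⟩ := ih fun C hC => hL C (by simp [hC])
          obtain ⟨M', hM', h₂⟩ := hL B (by simp)
          rcases hchain.total hM hM' with h | h
          · exact ⟨M', hM', by simpa using ⟨h₂, fun C hC => h (h₁ C hC)⟩⟩
          · exact ⟨M, hM, by simpa using ⟨h h₂, h₁⟩⟩
      exact (hc hMc).2 ⟨L, hLM, h⟩)
    S ⟨Set.subset_union_left, hS⟩
  refine ⟨M, hSM, hM.prop.1, hM.prop.2, fun A hA h => ?_⟩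
  exact hM.le_of_ge ⟨Set.insert_subset (.inr hA) hM.prop.1, h⟩ (Set.subset_insert A M)
    (Set.mem_insert A M)

/-- The maximal consistent sets of `Σ_CS`, which serve as possible worlds. Maximality is encoded as
negation completeness. -/
structure World (CS : Set (Form Ag)) : Type u where
  carrier : Set (Form Ag)
  consistent : ¬ Entails CS carrier bot
  complete : ∀ A, A ∈ carrier ∨ neg A ∈ carrier

instance : Membership (Form Ag) (World CS) := ⟨fun Γ A => A ∈ Γ.carrier⟩

theorem exists_world {S : Set (Form Ag)} (hS : ¬ Entails CS S bot) :
    ∃ Γ : World CS, ∀ A ∈ S, A ∈ Γ := by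
  obtain ⟨M, hSM, -, hM, hmax⟩ := exists_maximal_consistent Set.univ hS
  refine ⟨⟨M, hM, fun A => or_iff_not_imp_left.2 fun hA => ?_⟩, hSM⟩
  by_contra hn
  have h₁ := not_not.1 fun h => hA (hmax A trivial h)
  have h₂ := not_not.1 fun h => hn (hmax (neg A) trivial h)
  refine hM (.of_boolEval [imp A bot, imp (neg A) bot]
    (by simpa using ⟨h₁.imp_of_insert, h₂.imp_of_insert⟩) fun v => ?_)
  simp [boolEval_imp, boolEval_neg, boolEval_bot]

namespace World

theorem mem_of_entails (Γ : World CS) {A : Form Ag} (h : Entails CS Γ.carrier A) : A ∈ Γ := by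
  refine (Γ.complete A).resolve_right fun hn => Γ.consistent ?_
  refine .of_boolEval [A, neg A] (by simpa using ⟨h, .of_mem hn⟩) fun v => ?_
  simp [boolEval_neg]

theorem mem_of_provable (Γ : World CS) {A : Form Ag} (h : Provable CS A) : A ∈ Γ :=
  Γ.mem_of_entails (.of_provable h)

theorem mem_of_boolEval (Γ : World CS) (L : List (Form Ag)) {A : Form Ag}
    (hL : ∀ B ∈ L, B ∈ Γ) (h : ∀ v, (∀ B ∈ L, boolEval v B) → boolEval v A) : A ∈ Γ :=
  Γ.mem_of_entails (.of_boolEval L (fun B hB => .of_mem (hL B hB)) h)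

theorem bot_notMem (Γ : World CS) : bot ∉ Γ := fun h => Γ.consistent (.of_mem h)

theorem neg_mem (Γ : World CS) {A : Form Ag} : neg A ∈ Γ ↔ A ∉ Γ := by
  refine ⟨fun hn h => Γ.bot_notMem (Γ.mem_of_boolEval [A, neg A] (by simpa using ⟨h, hn⟩) ?_),
    fun h => (Γ.complete A).resolve_left h⟩
  intro v
  simp [boolEval_neg]

theorem mp (Γ : World CS) {A B : Form Ag} (h : imp A B ∈ Γ) (hA : A ∈ Γ) : B ∈ Γ :=
  Γ.mem_of_boolEval [A, imp A B] (by simpa using ⟨hA, h⟩) fun v => by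
    simp [boolEval_imp]; tauto

theorem mp_provable (Γ : World CS) {A B : Form Ag} (h : Provable CS (imp A B)) (hA : A ∈ Γ) :
    B ∈ Γ := Γ.mp (Γ.mem_of_provable h) hA

theorem mp_ax (Γ : World CS) {A B : Form Ag} (h : IsAxiom (imp A B)) (hA : A ∈ Γ) :
    B ∈ Γ := Γ.mp_provable (.ax h) hA

/-- Membership in a world is a classical valuation. -/
theorem boolEval_mem (Γ : World CS) (A : Form Ag) : boolEval (· ∈ Γ) A ↔ A ∈ Γ := by
  induction A with
  | and A B ihA ihB =>
    rw [boolEval_and, ihA, ihB]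
    refine ⟨fun h => Γ.mem_of_boolEval [A, B] (by simpa using h) fun v => ?_, fun h => ⟨?_, ?_⟩⟩
    · simp [boolEval_and]
    · exact Γ.mem_of_boolEval [_] (by simpa using h) fun v => by simp [boolEval_and]; tauto
    · exact Γ.mem_of_boolEval [_] (by simpa using h) fun v => by simp [boolEval_and]
  | neg A ih => rw [boolEval_neg, ih, neg_mem]
  | _ => exact Iff.rfl

theorem and_mem (Γ : World CS) {A B : Form Ag} : Form.and A B ∈ Γ ↔ A ∈ Γ ∧ B ∈ Γ := by
  rw [← boolEval_mem, boolEval_and, boolEval_mem, boolEval_mem]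

theorem conj_mem (Γ : World CS) {A : Form Ag} {L : List (Form Ag)} :
    conj A L ∈ Γ ↔ A ∈ Γ ∧ ∀ B ∈ L, B ∈ Γ := by
  rw [← boolEval_mem, boolEval_conj]
  simp only [boolEval_mem]

theorem foldr_imp_mem (Γ : World CS) {A : Form Ag} {L : List (Form Ag)} :
    L.foldr imp A ∈ Γ ↔ ((∀ B ∈ L, B ∈ Γ) → A ∈ Γ) := by
  rw [← boolEval_mem, boolEval_foldr_imp]
  simp only [boolEval_mem]

theorem disj_mem (Γ : World CS) {A : Form Ag} {L : List (Form Ag)} :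
    disj A L ∈ Γ ↔ A ∈ Γ ∨ ∃ B ∈ L, B ∈ Γ := by
  rw [← boolEval_mem, boolEval_disj]
  simp only [boolEval_mem]

end World

end MaximalConsistent

/-! ### Normal modalities -/

section Modalities

variable {CS : Set (Form Ag)}

/-- `N` is a normal modality of `Σ_CS`. -/
structure IsNormal (CS : Set (Form Ag)) (N : Form Ag → Form Ag) : Prop where
  nec : ∀ {A}, Provable CS A → Provable CS (N A)
  axK : ∀ A B, Provable CS (imp (N (imp A B)) (imp (N A) (N B)))

theorem provable_know_imp_box (A : Form Ag) : Provable CS (imp (know A) (box A)) :=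
  provable_of_boolEval [_, _, _] (by
    simpa using And.intro (Provable.ax (.a8 A)) (And.intro
      (Provable.ax (.a1_box (.ofS4 (.axT (know (box A))))))
      (Provable.ax (.a7 (.axT (box A)))))) fun v => by
    simp [boolEval_imp]; tauto

theorem isNormal_know : IsNormal CS (know : Form Ag → Form Ag) where
  nec := .r2
  axK A B := .ax (.a7 (.axK A B))

theorem isNormal_box : IsNormal CS (box : Form Ag → Form Ag) where
  nec h := .r1 (.r2 h) (provable_know_imp_box _)
  axK A B := .ax (.a1_box (.ofS4 (.axK A B)))

theorem isNormal_stit (j : Ag) : IsNormal CS (stit j) where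
  nec h := .r1 (isNormal_box.nec h) (.ax (.a2 j _))
  axK A B := .ax (.a1_stit j (.ofS4 (.axK A B)))

/-- The accessibility relation between worlds that a modality `N` induces. -/
def World.Acc (N : Form Ag → Form Ag) (Γ Δ : World CS) : Prop := ∀ A, N A ∈ Γ → A ∈ Δ

theorem IsNormal.mem_of_entails {N : Form Ag → Form Ag} (hN : IsNormal CS N) (Γ : World CS)
    {A : Form Ag} (h : Entails CS {B | N B ∈ Γ} A) : N A ∈ Γ := by
  obtain ⟨L, hL, h⟩ := h
  have := Γ.mem_of_provable (hN.nec h)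
  clear h
  induction L with
  | nil => exact this
  | cons B L ih =>
    exact ih (fun C hC => hL C (by simp [hC]))
      (Γ.mp (Γ.mp_provable (hN.axK _ _) this) (hL B (by simp)))

theorem IsNormal.exists_acc {N : Form Ag → Form Ag} (hN : IsNormal CS N) {Γ : World CS}
    {A : Form Ag} (h : N A ∉ Γ) : ∃ Δ : World CS, Γ.Acc N Δ ∧ A ∉ Δ := by
  have hcons : ¬ Entails CS (insert (neg A) {B | N B ∈ Γ}) bot := fun h' => by
    refine h (hN.mem_of_entails Γ (.of_boolEval [_] (by simpa using h'.imp_of_insert) fun v => ?_))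
    simp [boolEval_imp, boolEval_neg, boolEval_bot]
  obtain ⟨Δ, hΔ⟩ := exists_world hcons
  exact ⟨Δ, fun B hB => hΔ B (.inr hB), Δ.neg_mem.1 (hΔ _ (.inl rfl))⟩

/-- Finitely many formulas `N B` in a world are subsumed by a single one. -/
theorem IsNormal.exists_subsuming {N : Form Ag → Form Ag} (hN : IsNormal CS N) (Γ : World CS)
    {L : List (Form Ag)} (hL : ∀ B ∈ L, N B ∈ Γ) :
    ∃ A, N A ∈ Γ ∧ ∀ B ∈ L, Provable CS (imp (N A) (N B)) := by
  have key (B) (hB : B ∈ L) : Provable CS (imp (conj (neg bot) L) B) :=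
    provable_of_boolEval [] (by simp) fun v _ => by
      rw [boolEval_imp, boolEval_conj]
      exact fun h => h.2 B hB
  refine ⟨conj (neg bot) L, hN.mem_of_entails Γ ?_, fun B hB =>
    .r1 (hN.nec (key B hB)) (hN.axK _ _)⟩
  refine .of_boolEval L (fun B hB => .of_mem (hL B hB)) fun v hv => ?_
  rw [boolEval_conj]
  exact ⟨boolEval_bot v, hv⟩

/-- For an `S5` modality, accessible worlds contain the same boxed formulas. -/
theorem World.Acc.mem_iff {N : Form Ag → Form Ag}
    (hN : ∀ A, S5Axiom N A → Provable CS A) {Γ Δ : World CS} (h : Γ.Acc N Δ) (A : Form Ag) :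
    N A ∈ Γ ↔ N A ∈ Δ := by
  refine ⟨fun hA => h _ (Γ.mp_provable (hN _ (.ofS4 (.ax4 A))) hA), fun hA => ?_⟩
  by_contra hn
  exact Δ.neg_mem.1 (h _ (Γ.mp_provable (hN _ (.ax5 A)) (Γ.neg_mem.2 hn))) hA

theorem World.acc_refl {N : Form Ag → Form Ag} (hN : ∀ A, S4Axiom N A → Provable CS A)
    (Γ : World CS) : Γ.Acc N Γ := fun A hA => Γ.mp_provable (hN _ (.axT A)) hA

theorem World.Acc.trans {N : Form Ag → Form Ag} (hN : ∀ A, S4Axiom N A → Provable CS A)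
    {Γ Δ Θ : World CS} (h₁ : Γ.Acc N Δ) (h₂ : Δ.Acc N Θ) : Γ.Acc N Θ :=
  fun A hA => h₂ _ (h₁ _ (Γ.mp_provable (hN _ (.ax4 A)) hA))

theorem World.Acc.symm {N : Form Ag → Form Ag}
    (hN : ∀ A, S5Axiom N A → Provable CS A) {Γ Δ : World CS} (h : Γ.Acc N Δ) : Δ.Acc N Γ :=
  fun A hA => Γ.acc_refl (fun _ h => hN _ (.ofS4 h)) A ((h.mem_iff hN A).2 hA)

theorem provable_s5_box (A : Form Ag) (h : S5Axiom box A) : Provable CS A := .ax (.a1_box h)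

theorem provable_s5_stit (j : Ag) (A : Form Ag) (h : S5Axiom (stit j) A) : Provable CS A :=
  .ax (.a1_stit j h)

theorem provable_s4_know (A : Form Ag) (h : S4Axiom know A) : Provable CS A := .ax (.a7 h)

theorem provable_s4_box (A : Form Ag) (h : S4Axiom box A) : Provable CS A :=
  .ax (.a1_box (.ofS4 h))

theorem provable_s4_stit (j : Ag) (A : Form Ag) (h : S4Axiom (stit j) A) : Provable CS A :=
  .ax (.a1_stit j (.ofS4 h))

theorem World.Acc.box_of_stit {j : Ag} {Γ Δ : World CS} (h : Γ.Acc (stit j) Δ) :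
    Γ.Acc box Δ := fun A hA => h A (Γ.mp_ax (.a2 j A) hA)

/-- Knowledge is settled: worlds of the same moment contain the same formulas `KA`. -/
theorem World.Acc.know_mem_iff {Γ Δ : World CS} (h : Γ.Acc box Δ) (A : Form Ag) :
    know A ∈ Γ ↔ know A ∈ Δ := by
  have key {Γ Δ : World CS} (h : Γ.Acc box Δ) (hA : know A ∈ Γ) : know A ∈ Δ :=
    h _ (Γ.mp_provable (provable_know_imp_box _) (Γ.mp_ax (.a7 (.ax4 A)) hA))
  exact ⟨key h, key (h.symm provable_s5_box)⟩

theorem World.know_just_mem (Γ : World CS) {t : Pol} {A : Form Ag} (h : just t A ∈ Γ) :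
    know (just t A) ∈ Γ :=
  (Γ.and_mem.1 (Γ.mp_ax (.a5 _ _) (Γ.and_mem.1 (Γ.mp_ax (.a5 t A) h)).1)).2

theorem World.Acc.just_mem_iff {Γ Δ : World CS} (h : Γ.Acc box Δ) (t : Pol) (A : Form Ag) :
    just t A ∈ Γ ↔ just t A ∈ Δ := by
  have key {Γ Δ : World CS} (h : Γ.Acc box Δ) (hA : just t A ∈ Γ) : just t A ∈ Δ :=
    Δ.mp_ax (.a7 (.axT _)) ((h.know_mem_iff _).1 (Γ.know_just_mem hA))
  exact ⟨key h, key (h.symm provable_s5_box)⟩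

theorem World.diamond_mem {Γ Δ : World CS} {A : Form Ag} (h : Γ.Acc box Δ) (hA : A ∈ Δ) :
    dia A ∈ Γ := Γ.neg_mem.2 fun hn => Δ.neg_mem.1 (h _ hn) hA

/-- Independence of agents for worlds: if `G j` lies in the `□`-class of `Γ` for every agent `j`,
then some world of this class lies in the `[j]`-class of `G j` for all `j` at once. -/
theorem World.exists_acc_stit [Finite Ag] (Γ : World CS) (G : Ag → World CS)
    (hG : ∀ j, Γ.Acc box (G j)) :
    ∃ Δ : World CS, Γ.Acc box Δ ∧ ∀ j, (G j).Acc (stit j) Δ := by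
  classical
  have hcons : ¬ Entails CS ({A | box A ∈ Γ} ∪ {A | ∃ j B, A = stit j B ∧ stit j B ∈ G j})
      bot := by
    intro h
    obtain ⟨L, hL, h⟩ := h.exists_discharge
    have hbox := isNormal_box.mem_of_entails Γ h
    -- Subsume the discharged premises of agent `j` by a single formula `[j](F j)`.
    have hsub (j : Ag) : ∃ A, stit j A ∈ G j ∧
        ∀ B, stit j B ∈ L → stit j B ∈ G j → Provable CS (imp (stit j A) (stit j B)) := by
      let L' : List (Form Ag) := L.flatMap fun C => match C with
        | stit i B => if i = j ∧ stit j B ∈ G j then [B] else []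
        | _ => []
      obtain ⟨A, hA, hA'⟩ := (isNormal_stit j).exists_subsuming (G j) (L := L') (fun B hB => by
        obtain ⟨C, -, hC⟩ := List.mem_flatMap.1 hB
        split at hC
        · split_ifs at hC with hi
          · rw [List.mem_singleton.1 hC]; exact hi.2
          · simp at hC
        · simp at hC)
      refine ⟨A, hA, fun B hB hBG => hA' B (List.mem_flatMap.2 ⟨_, hB, ?_⟩)⟩
      simp [hBG]
    choose F hF hF' using hsub
    have := Fintype.ofFinite Ag
    -- A world in the class of `Γ` that contains all `[j](F j)` refutes `hbox`.
    have contra (Θ : World CS) (hΘ : Γ.Acc box Θ) (hF'' : ∀ j, stit j (F j) ∈ Θ) : False := by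
      refine Θ.bot_notMem (Θ.foldr_imp_mem.1 (hΘ _ hbox) fun B hB => ?_)
      obtain ⟨j, B, rfl, hBG⟩ := hL _ hB
      exact Θ.mp_provable (hF' j B hB hBG) (hF'' j)
    have hnodup := (Finset.univ : Finset Ag).nodup_toList
    have hmem : ∀ j : Ag, j ∈ (Finset.univ : Finset Ag).toList := by simp
    rcases hl : (Finset.univ : Finset Ag).toList with _ | ⟨i, l⟩
    · exact contra Γ (Γ.acc_refl provable_s4_box) fun j => by simpa [hl] using hmem j
    · rw [hl] at hnodup hmem
      have hd (j : Ag) : dia (stit j (F j)) ∈ Γ := World.diamond_mem (hG j) (hF j)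
      have h3 := Γ.mp_ax (.a3 (i, F i) (l.map fun j => (j, F j))
        (by simpa [Function.comp_def] using hnodup))
        (Γ.conj_mem.2 ⟨hd i, by simpa using fun j _ => hd j⟩)
      obtain ⟨Θ, hΘ, hΘ'⟩ := isNormal_box.exists_acc (Γ.neg_mem.1 h3)
      have hc := Θ.conj_mem.1 (by simpa [World.neg_mem] using hΘ')
      refine contra Θ hΘ fun j => ?_
      rcases List.mem_cons.1 (hmem j) with rfl | hj
      · exact hc.1
      · exact hc.2 _ (List.mem_map_of_mem hj)
  obtain ⟨Δ, hΔ⟩ := exists_world hcons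
  exact ⟨Δ, fun A hA => hΔ A (.inl hA), fun j A hA =>
    Δ.mp_ax (.a1_stit j (.ofS4 (.axT A))) (hΔ _ (.inr ⟨j, A, rfl, hA⟩))⟩

/-- The rule `(R4)` in terms of worlds: it is consistent that everything known in `Γ` stays known
while all proofs presented in `Γ` become settled. -/
theorem World.consistent_settled (Γ : World CS) :
    ¬ Entails CS ({A | A ∈ Γ ∧ ∃ B, A = know B} ∪ {A | ∃ t, A = box (pres t) ∧ pres t ∈ Γ})
      bot := by
  intro h
  obtain ⟨L, hL, L', hL', h⟩ := h.exists_discharge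
  obtain ⟨A, hA, hAL⟩ : ∃ A, know A ∈ Γ ∧ ∀ B ∈ L', Provable CS (imp (know A) B) := by
    obtain ⟨L'', hL''⟩ : ∃ L'' : List (Form Ag), L' = L''.map know := by
      refine ⟨L'.map fun C => match C with | know B => B | C => C, ?_⟩
      rw [List.map_map]
      refine (List.map_id L').symm.trans (List.map_congr_left fun C hC => ?_)
      obtain ⟨-, B, rfl⟩ := hL' C hC
      rfl
    subst hL''
    obtain ⟨A, hA, hA'⟩ := isNormal_know.exists_subsuming Γ (L := L'')
      (fun B hB => (hL' _ (List.mem_map_of_mem hB)).1)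
    exact ⟨A, hA, by simpa using hA'⟩
  obtain ⟨T, hT⟩ : ∃ T : List Pol, L = T.map fun t => box (pres t) := by
    refine ⟨L.map fun C => match C with | box (pres t) => t | _ => .var 0, ?_⟩
    rw [List.map_map]
    refine (List.map_id L).symm.trans (List.map_congr_left fun C hC => ?_)
    obtain ⟨t, rfl, -⟩ := hL C hC
    rfl
  subst hT
  have hTΓ : ∀ t ∈ T, pres t ∈ Γ := fun t ht => by
    obtain ⟨s, hs, hs'⟩ := hL _ (List.mem_map_of_mem ht)
    simp only [box.injEq, pres.injEq] at hs
    exact hs ▸ hs'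
  have hprov : Provable CS (imp (know A) ((T.map fun t => box (pres t)).foldr imp bot)) := by
    refine provable_of_boolEval
      (L'.foldr imp ((T.map fun t => box (pres t)).foldr imp bot) :: L'.map (imp (know A)))
      ?_ fun v hv => ?_
    · simpa using ⟨h, hAL⟩
    · simp only [List.mem_cons, List.mem_map, forall_eq_or_imp, forall_exists_index, and_imp,
        forall_apply_eq_imp_iff₂, boolEval_imp, boolEval_foldr_imp v L'] at hv
      rw [boolEval_imp]
      exact fun hA => hv.1 fun B hB => hv.2 B hB hA
  cases T with
  | nil => exact Γ.bot_notMem (Γ.mp_provable hprov hA)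
  | cons t T =>
    have h4 : Provable CS (imp (know A)
        (disj (neg (box (pres t))) (T.map fun s => neg (box (pres s))))) := by
      refine provable_of_boolEval [_] (by simpa using hprov) fun v hv => ?_
      simp only [List.mem_cons, List.not_mem_nil, or_false, forall_eq, boolEval_imp,
        boolEval_foldr_imp, boolEval_disj, boolEval_bot, List.mem_map, boolEval_neg] at hv ⊢
      intro hA
      by_contra! hc
      refine hv hA hc.1 fun B hB => ?_
      obtain ⟨s, hs, rfl⟩ := hB
      exact not_not.1 (hc.2 _ ⟨s, hs, rfl⟩)
    have := Γ.mp_provable (.r4 h4) hA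
    rw [Γ.disj_mem] at this
    rcases this with h | ⟨B, hB, h⟩
    · exact Γ.neg_mem.1 h (hTΓ t (by simp))
    · obtain ⟨s, hs, rfl⟩ := List.mem_map.1 hB
      exact Γ.neg_mem.1 h (hTΓ s (by simp [hs]))

/-- Every world has a successor that keeps its knowledge, settles its proofs, and in whose moment
no world presents a proof that is not settled. -/
theorem World.exists_mature (Γ : World CS) :
    ∃ Δ : World CS, Γ.Acc know Δ ∧ (∀ t, pres t ∈ Γ → box (pres t) ∈ Δ) ∧
      ∀ Θ : World CS, Δ.Acc box Θ → ∀ t, pres t ∈ Θ → box (pres t) ∈ Δ := by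
  obtain ⟨M, hM₁, hM₂, hM, hmax⟩ :=
    exists_maximal_consistent {A | ∃ t, A = box (pres t)} Γ.consistent_settled
  obtain ⟨Δ, hΔ⟩ := exists_world hM
  refine ⟨Δ, fun A hA => Δ.mp_ax (.a7 (.axT A)) (hΔ _ (hM₁ (.inl ⟨hA, A, rfl⟩))),
    fun t ht => hΔ _ (hM₁ (.inr ⟨t, rfl, ht⟩)), fun Θ hΘ t ht => hΔ _ (hmax _ ⟨t, rfl⟩ ?_)⟩
  -- `M` with `□Et` added is part of the set that `consistent_settled` provides for `Θ`.
  refine fun h => Θ.consistent_settled (h.mono ?_)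
  have hpres {s : Pol} (hs : box (pres s) ∈ M) : pres s ∈ Θ := hΘ _ (hΔ _ hs)
  rintro A (rfl | hA)
  · exact .inr ⟨t, rfl, ht⟩
  · rcases hM₂ hA with (⟨h, B, rfl⟩ | ⟨s, rfl, -⟩) | ⟨s, rfl⟩
    · exact .inl ⟨(hΘ.know_mem_iff _).1 (hΔ _ hA), B, rfl⟩
    · exact .inr ⟨s, rfl, hpres hA⟩
    · exact .inr ⟨s, rfl, hpres hA⟩

end Modalities

/-! ### Soundness -/

section Soundness

namespace Model

variable (M : Model Ag)

theorem sat_imp {m : M.Tree} {h : Hist M.Tree} {A B : Form Ag} :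
    M.Sat m h (imp A B) ↔ (M.Sat m h A → M.Sat m h B) := by
  simp [imp, Sat]

theorem boolEval_sat (m : M.Tree) (h : Hist M.Tree) (A : Form Ag) :
    boolEval (M.Sat m h) A ↔ M.Sat m h A := by
  induction A with
  | and A B ihA ihB => rw [boolEval_and, ihA, ihB, Sat]
  | neg A ih => rw [boolEval_neg, ih, Sat]
  | _ => exact Iff.rfl

theorem sat_or {m : M.Tree} {h : Hist M.Tree} {A B : Form Ag} :
    M.Sat m h (Form.or A B) ↔ (M.Sat m h A ∨ M.Sat m h B) := by
  simp only [← boolEval_sat, boolEval_or]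

theorem sat_conj {m : M.Tree} {h : Hist M.Tree} {A : Form Ag} {L : List (Form Ag)} :
    M.Sat m h (conj A L) ↔ M.Sat m h A ∧ ∀ B ∈ L, M.Sat m h B := by
  simp only [← boolEval_sat, boolEval_conj]

theorem sat_disj {m : M.Tree} {h : Hist M.Tree} {A : Form Ag} {L : List (Form Ag)} :
    M.Sat m h (disj A L) ↔ M.Sat m h A ∨ ∃ B ∈ L, M.Sat m h B := by
  simp only [← boolEval_sat, boolEval_disj]

theorem sat_dia {m : M.Tree} {h : Hist M.Tree} {A : Form Ag} :
    M.Sat m h (dia A) ↔ ∃ h' ∈ histThrough m, M.Sat m h' A := by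
  simp [dia, Sat]

theorem cell_subset {m : M.Tree} {j : Ag} {h h' : Hist M.Tree} (hh : h' ∈ M.cell m j h) :
    h' ∈ histThrough m := by
  obtain ⟨s, hs, -, hs'⟩ := hh
  exact M.choice_sub m j s hs hs'

theorem mem_cell_self {m : M.Tree} {j : Ag} {h : Hist M.Tree} (hh : h ∈ histThrough m) :
    h ∈ M.cell m j h := by
  obtain ⟨s, ⟨hs, hs'⟩, -⟩ := M.choice_unique m j h hh
  exact ⟨s, hs, hs', hs'⟩

theorem cell_eq {m : M.Tree} {j : Ag} {h h' : Hist M.Tree} (hh : h' ∈ M.cell m j h) :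
    M.cell m j h' = M.cell m j h := by
  obtain ⟨s, hs, h₁, h₂⟩ := hh
  have key {h : Hist M.Tree} (h₁ : h ∈ s) : M.cell m j h = s := by
    refine Set.Subset.antisymm ?_ fun k hk => ⟨s, hs, h₁, hk⟩
    rintro k ⟨s', hs', h₁', hk⟩
    rwa [(M.choice_unique m j h (M.choice_sub m j s hs h₁)).unique ⟨hs, h₁⟩ ⟨hs', h₁'⟩]
  rw [key h₁, key h₂]

theorem cell_mem_choice {m : M.Tree} {j : Ag} {h : Hist M.Tree} (hh : h ∈ histThrough m) :
    M.cell m j h ∈ M.Choice m j := by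
  obtain ⟨s, ⟨hs, hs'⟩, hu⟩ := M.choice_unique m j h hh
  convert hs
  refine Set.Subset.antisymm ?_ fun k hk => ⟨s, hs, hs', hk⟩
  rintro k ⟨s', hs₁, h₁, hk⟩
  rwa [← hu s' ⟨hs₁, h₁⟩]

/-- The `S4` axioms hold for a modality that quantifies over the successors of a preorder on
moment-history pairs. -/
theorem validates_s4 {N : Form Ag → Form Ag}
    {r : M.Tree × Hist M.Tree → M.Tree × Hist M.Tree → Prop}
    (hN : ∀ m h A, h ∈ histThrough m → (M.Sat m h (N A) ↔
      ∀ q, r (m, h) q → q.2 ∈ histThrough q.1 → M.Sat q.1 q.2 A))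
    (hrefl : ∀ m h, h ∈ histThrough m → r (m, h) (m, h))
    (htrans : ∀ p q q', r p q → r q q' → r p q')
    {A : Form Ag} (hA : S4Axiom N A) : M.Validates A := by
  intro m h hh
  cases hA with
  | axK A B =>
    simp only [sat_imp, hN _ _ _ hh]
    exact fun h₁ h₂ q hq hq' => h₁ q hq hq' (h₂ q hq hq')
  | axT A =>
    simp only [sat_imp, hN _ _ _ hh]
    exact fun h₁ => h₁ (m, h) (hrefl m h hh) hh
  | ax4 A =>
    simp only [sat_imp, hN _ _ _ hh]
    refine fun h₁ q hq hq' => (hN _ _ _ hq').2 fun q' hq₁ hq₂ => h₁ q' (htrans _ _ _ hq hq₁) hq₂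

/-- The `S5` axioms hold for a modality that quantifies over the classes of an equivalence relation
on moment-history pairs. -/
theorem validates_s5 {N : Form Ag → Form Ag}
    {r : M.Tree × Hist M.Tree → M.Tree × Hist M.Tree → Prop}
    (hN : ∀ m h A, h ∈ histThrough m → (M.Sat m h (N A) ↔
      ∀ q, r (m, h) q → q.2 ∈ histThrough q.1 → M.Sat q.1 q.2 A))
    (hrefl : ∀ m h, h ∈ histThrough m → r (m, h) (m, h))
    (htrans : ∀ p q q', r p q → r q q' → r p q')
    (hsymm : ∀ p q, r p q → r q p)
    {A : Form Ag} (hA : S5Axiom N A) : M.Validates A := by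
  cases hA with
  | ofS4 hA => exact M.validates_s4 hN hrefl htrans hA
  | axB A =>
    intro m h hh
    rw [sat_imp, hN _ _ _ hh]
    intro h₁ q hq hq' h₂
    exact (hN _ _ _ hq').1 h₂ (m, h) (hsymm _ _ hq) hh h₁
  | ax5 A =>
    intro m h hh
    rw [sat_imp, hN _ _ _ hh]
    intro h₁ q hq hq' h₂
    exact h₁ ((hN _ _ _ hh).2 fun q' hq₁ hq₂ =>
      (hN _ _ _ hq').1 h₂ q' (htrans _ _ _ (hsymm _ _ hq) hq₁) hq₂)

theorem validates_s5_box {A : Form Ag} (hA : S5Axiom box A) : M.Validates A := by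
  refine M.validates_s5 (r := fun p q => p.1 = q.1) (fun m h A hh => ?_) (fun _ _ _ => rfl)
    (fun _ _ _ => Eq.trans) (fun _ _ => Eq.symm) hA
  rw [Sat]
  refine ⟨?_, fun h₁ h' hh' => h₁ (m, h') rfl hh'⟩
  rintro h₁ ⟨m', h'⟩ rfl hq
  exact h₁ h' hq

theorem validates_s5_stit (j : Ag) {A : Form Ag} (hA : S5Axiom (stit j) A) :
    M.Validates A := by
  refine M.validates_s5 (r := fun p q => p.1 = q.1 ∧ q.2 ∈ M.cell p.1 j p.2)
    (fun m h A hh => ?_) (fun m h hh => ⟨rfl, M.mem_cell_self hh⟩) ?_ ?_ hA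
  · rw [Sat]
    refine ⟨?_, fun h₁ h' hh' => h₁ (m, h') ⟨rfl, hh'⟩ (M.cell_subset hh')⟩
    rintro h₁ ⟨m', h'⟩ ⟨rfl, hq'⟩ -
    exact h₁ h' hq'
  · rintro ⟨m, h⟩ ⟨m', h'⟩ ⟨m'', h''⟩ ⟨rfl, h₁⟩ ⟨rfl, h₂⟩
    exact ⟨rfl, M.cell_eq h₁ ▸ h₂⟩
  · rintro ⟨m, h⟩ ⟨m', h'⟩ ⟨rfl, s, hs, h₁, h₂⟩
    exact ⟨rfl, s, hs, h₂, h₁⟩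

theorem validates_s4_know {A : Form Ag} (hA : S4Axiom know A) : M.Validates A := by
  refine M.validates_s4 (r := fun p q => M.R p.1 q.1) (fun m h A _ => ?_)
    (fun _ _ _ => M.R_refl _) (fun _ _ _ => M.R_trans _ _ _) hA
  rw [Sat]
  exact ⟨fun h₁ q hq hq' => h₁ q.1 hq q.2 hq', fun h₁ m' hm h' hh => h₁ (m', h') hm hh⟩

theorem sat_a3 {m : M.Tree} {h : Hist M.Tree} (hh : h ∈ histThrough m)
    (p : Ag × Form Ag) (L : List (Ag × Form Ag)) (hnodup : ((p :: L).map Prod.fst).Nodup) :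
    M.Sat m h (imp
      (conj (dia (stit p.1 p.2)) (L.map fun q => dia (stit q.1 q.2)))
      (dia (conj (stit p.1 p.2) (L.map fun q => stit q.1 q.2)))) := by
  classical
  rw [sat_imp, sat_conj, sat_dia, sat_dia]
  rintro ⟨hp, hL⟩
  have hall : ∀ q ∈ p :: L, ∃ h' ∈ histThrough m, M.Sat m h' (stit q.1 q.2) := by
    intro q hq
    rcases List.mem_cons.1 hq with rfl | hq
    · exact hp
    · exact M.sat_dia.1 (hL _ (List.mem_map_of_mem hq))
  -- The agents of the list use the cells that the premises provide, all others the cell of `h`.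
  have hcell (j : Ag) : ∃ k ∈ histThrough m, ∀ q ∈ p :: L, q.1 = j → M.Sat m k (stit q.1 q.2) := by
    by_cases hj : ∃ q ∈ p :: L, q.1 = j
    · obtain ⟨q, hq, rfl⟩ := hj
      obtain ⟨k, hk, hsat⟩ := hall q hq
      refine ⟨k, hk, fun q' hq' he => ?_⟩
      rwa [List.inj_on_of_nodup_map hnodup hq' hq he]
    · exact ⟨h, hh, fun q hq he => absurd ⟨q, hq, he⟩ hj⟩
  choose k hk hsat using hcell
  obtain ⟨g, hg⟩ := M.independence m (fun j => M.cell m j (k j)) fun j => M.cell_mem_choice (hk j)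
  have hg' (j : Ag) : g ∈ M.cell m j (k j) := Set.mem_iInter.1 hg j
  have hgood : ∀ q ∈ p :: L, M.Sat m g (stit q.1 q.2) := by
    intro q hq
    have := hsat q.1 q hq rfl
    rw [Sat] at this ⊢
    rwa [M.cell_eq (hg' q.1)]
  refine ⟨g, M.cell_subset (hg' p.1), M.sat_conj.2 ⟨hgood p (by simp), ?_⟩⟩
  intro B hB
  obtain ⟨q, hq, rfl⟩ := List.mem_map.1 hB
  exact hgood q (by simp [hq])

theorem validates_of_isAxiom {A : Form Ag} (hA : IsAxiom A) : M.Validates A := by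
  intro m h hh
  cases hA with
  | a0 hA => exact (M.boolEval_sat m h A).1 (hA _)
  | a1_box hA => exact M.validates_s5_box hA m h hh
  | a1_stit j hA => exact M.validates_s5_stit j hA m h hh
  | a2 j A =>
    simp only [sat_imp, Sat]
    exact fun h₁ h' hh' => h₁ h' (M.cell_subset hh')
  | a3 p L hnodup => exact M.sat_a3 hh p L hnodup
  | a4 s t A B =>
    simp only [sat_imp, Sat]
    exact fun h₁ h₂ => ⟨M.evidence_app m s t A B h₁.1 h₂.1,
      fun m' hm h' hh' => h₁.2 m' hm h' hh' (h₂.2 m' hm h' hh')⟩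
  | a5 t A =>
    simp only [sat_imp, Sat]
    refine fun h₁ => ⟨⟨M.evidence_bang m t A h₁.1, fun m' hm h' _ =>
      ⟨M.evidence_mono t m m' hm h₁.1, fun m'' hm' => h₁.2 m'' (M.Re_trans _ _ _ hm hm')⟩⟩,
      fun m' hm => h₁.2 m' (M.R_sub_Re _ _ hm)⟩
  | a6 s t A =>
    simp only [sat_imp, sat_or, Sat]
    rintro (h₁ | h₁)
    · exact ⟨M.evidence_sum m s t (.inl h₁.1), h₁.2⟩
    · exact ⟨M.evidence_sum m s t (.inr h₁.1), h₁.2⟩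
  | a7 hA => exact M.validates_s4_know hA m h hh
  | a8 A =>
    simp only [sat_imp, Sat]
    exact fun h₁ _ _ m' hm _ _ => h₁ m' hm
  | a9 t =>
    simp only [sat_imp, Sat]
    intro h₁ m' hm _ _ h' hh'
    exact Set.mem_iInter₂.1 (M.transparency m m' (M.R_sub_Re _ _ hm)
      (Set.mem_iInter₂.2 h₁)) h' hh'

/-- A history that ends with the moment `m` is the only one through `m`. -/
theorem histThrough_subsingleton_of_forall_not_lt {T : Type u} [PartialOrder T]
    (hback : ∀ m m₁ m₂ : T, m₁ ≤ m → m₂ ≤ m → m₁ ≤ m₂ ∨ m₂ ≤ m₁) {m : T} {h : Hist T}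
    (hh : h ∈ histThrough m) (htop : ∀ m' ∈ h.1, ¬ m < m') {h' : Hist T}
    (hh' : h' ∈ histThrough m) : h' = h := by
  have hle : h.1 ⊆ Set.Iic m := fun x hx => by
    rcases h.2.1.total hx hh with hx' | hx'
    · exact hx'
    · exact (eq_or_lt_of_le hx').elim (fun e => e.ge) fun hlt => absurd hlt (htop x hx)
  have hmax (k : Set T) (hk : IsChain (· ≤ ·) k) (hmk : m ∈ k) (x : T) (hx : x ∈ k)
      (hmx : m ≤ x) : x ∈ h.1 := by
    have : IsChain (· ≤ ·) (insert x h.1) := h.2.1.insert fun y hy _ =>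
      .inr ((hle hy).trans hmx)
    rw [h.2.2 this (Set.subset_insert _ _)]
    exact Set.mem_insert _ _
  have hle' : h'.1 ⊆ Set.Iic m := fun x hx => by
    rcases h'.2.1.total hx hh' with hx' | hx'
    · exact hx'
    · exact hle (hmax h'.1 h'.2.1 hh' x hx hx')
  have hIic : IsChain (· ≤ ·) (Set.Iic m) := fun x hx y hy _ => hback m x y hx hy
  exact Subtype.ext ((h'.2.2 hIic hle').trans (h.2.2 hIic hle).symm)

/-- The semantic content of `(R4)`: presented proofs get settled as soon as time moves on, and a
last moment belongs to a single history. -/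
theorem exists_settled {m : M.Tree} {h : Hist M.Tree} (hh : h ∈ histThrough m) :
    ∃ m' ∈ h.1, m ≤ m' ∧ ∀ t ∈ M.Act m h, ∀ h' ∈ histThrough m', t ∈ M.Act m' h' := by
  by_cases hex : ∃ m' ∈ h.1, m < m'
  · obtain ⟨m', hm', hlt⟩ := hex
    refine ⟨m', hm', hlt.le, fun t ht h' hh' => ?_⟩
    have hmh' : h' ∈ histThrough m := by
      have : IsChain (· ≤ ·) (insert m h'.1) := h'.2.1.insert fun y hy _ => by
        rcases h'.2.1.total hy hh' with hy' | hy'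
        · exact M.no_backward_branching m' m y hlt.le hy'
        · exact .inl (hlt.le.trans hy')
      change m ∈ h'.1
      rw [h'.2.2 this (Set.subset_insert _ _)]
      exact Set.mem_insert _ _
    refine M.expansion m' m hlt h' hh' ?_
    rwa [M.new_proof_divides m h' hmh' h hh ⟨m', hlt, hh', hm'⟩]
  · push Not at hex
    refine ⟨m, hh, le_rfl, fun t ht h' hh' => ?_⟩
    rwa [histThrough_subsingleton_of_forall_not_lt M.no_backward_branching hh hex hh']

theorem validates_of_provable {CS : Set (Form Ag)} (hCS : IsConstSpec CS)
    (hM : M.RespectsCS CS) {A : Form Ag} (hA : Provable CS A) : M.Validates A := by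
  induction hA with
  | ax hA => exact M.validates_of_isAxiom hA
  | r1 _ _ ih₁ ih₂ => exact fun m h hh => M.sat_imp.1 (ih₂ m h hh) (ih₁ m h hh)
  | r2 _ ih =>
    intro m h _
    rw [Sat]
    exact fun m' _ h' hh' => ih m' h' hh'
  | @r4 A t L _ ih =>
    intro m h hh
    rw [sat_imp]
    intro hA
    by_contra hc
    rw [sat_disj, not_or] at hc
    have hact : ∀ s ∈ t :: L, s ∈ M.Act m h := by
      intro s hs
      by_contra hn
      rcases List.mem_cons.1 hs with rfl | hs
      · exact hc.1 hn
      · exact hc.2 ⟨_, List.mem_map_of_mem hs, hn⟩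
    obtain ⟨m', hm', hle, hset⟩ := M.exists_settled hh
    have hA' : M.Sat m' h (know A) := by
      rw [Sat] at hA ⊢
      exact fun m'' hm => hA m'' (M.R_trans _ _ _ (M.future_matters _ _ hle) hm)
    rcases M.sat_disj.1 (M.sat_imp.1 (ih m' h hm') hA') with hs | ⟨B, hB, hs⟩
    · exact hs fun h' hh' => hset t (hact t (by simp)) h' hh'
    · obtain ⟨s, hs', rfl⟩ := List.mem_map.1 hB
      exact hs fun h' hh' => hset s (hact s (by simp [hs'])) h' hh'
  | @rcs A hA =>
    obtain ⟨l, A, hl, hax, rfl⟩ := hCS.form A hA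
    induction l with
    | nil => exact absurd rfl hl
    | cons c l ih =>
      have hval : M.Validates (constPrefix l A) := by
        rcases eq_or_ne l [] with rfl | hl'
        · exact M.validates_of_isAxiom hax
        · exact ih hl' (hCS.tail c l A hl' hax hA)
      intro m h _
      rw [constPrefix, Sat]
      exact ⟨hM c m hA, fun m' _ h' hh' => hval m' h' hh'⟩

theorem consistent_of_satisfies {CS : Set (Form Ag)} (hCS : IsConstSpec CS)
    (hM : M.RespectsCS CS) {m : M.Tree} {h : Hist M.Tree} (hh : h ∈ histThrough m)
    {Γ : Set (Form Ag)} (hΓ : ∀ A ∈ Γ, M.Sat m h A) : ¬ Entails CS Γ bot := by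
  rintro ⟨L, hL, hprov⟩
  have := M.validates_of_provable hCS hM hprov m h hh
  rw [← boolEval_sat, boolEval_foldr_imp] at this
  exact boolEval_bot _ (this fun B hB => (M.boolEval_sat m h B).2 (hΓ B (hL B hB)))

end Model

theorem exists_hist_of_le {T : Type u} [PartialOrder T] {m m' : T} (h : m ≤ m') :
    ∃ k : Hist T, k ∈ histThrough m ∧ k ∈ histThrough m' := by
  obtain ⟨c, hc, hsub⟩ := (IsChain.pair h).exists_maxChain
  exact ⟨⟨c, hc⟩, hsub (by simp), hsub (by simp)⟩

/-- The model with a single moment, where every formula has evidence and no proof is presented. -/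
def pointModel (Ag : Type u) : Model Ag where
  Tree := PUnit
  Choice m _ := {histThrough m}
  Act _ _ := ∅
  R _ _ := True
  Re _ _ := True
  Ev _ _ := Set.univ
  V _ := ∅
  choice_sub m j s hs := by rw [hs]
  choice_nonempty m j s hs := by
    rw [hs]
    obtain ⟨h, hh, -⟩ := exists_hist_of_le (le_refl m)
    exact ⟨h, hh⟩
  choice_unique m j h hh := ⟨_, ⟨rfl, hh⟩, fun s hs => hs.1⟩
  R_refl _ := trivial
  R_trans _ _ _ _ _ := trivial
  Re_refl _ := trivial
  Re_trans _ _ _ _ _ := trivial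
  R_sub_Re _ _ _ := trivial
  historical_connection m m₁ := ⟨m, le_rfl, le_rfl⟩
  no_backward_branching _ _ _ _ _ := .inl le_rfl
  no_choice_undivided m m' j h _ h' _ hlt := absurd hlt (lt_irrefl _)
  independence m f hf := by
    obtain ⟨h, hh, -⟩ := exists_hist_of_le (le_refl m)
    refine ⟨h, Set.mem_iInter.2 fun j => ?_⟩
    rw [hf j]
    exact hh
  evidence_mono _ _ _ _ := subset_rfl
  evidence_app _ _ _ _ _ _ _ := trivial
  evidence_sum _ _ _ := Set.subset_univ _
  evidence_bang _ _ _ _ := trivial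
  expansion _ _ _ _ _ := subset_rfl
  no_new_proofs_guaranteed m t ht := by
    obtain ⟨h, hh, -⟩ := exists_hist_of_le (le_refl m)
    exact (Set.mem_iInter₂.1 ht h hh).elim
  new_proof_divides _ _ _ _ _ _ := rfl
  future_matters _ _ _ := trivial
  transparency _ _ _ := subset_rfl

end Soundness

/-! ### The tree of initial segments -/

section SequenceTree

/-- An initial segment, with domain `{i | i < time}`, of a `W`-valued sequence over the linear order
`I`. Segments are encoded as total functions with the junk value `d` outside their domain. -/
@[ext]
structure Moment (I : Type) [LinearOrder I] {W : Type u} (d : W) : Type u where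
  time : I
  path : I → W
  path_eq : ∀ i, time ≤ i → path i = d

variable {I : Type} [LinearOrder I] {W : Type u} {d : W}

namespace Moment

instance : PartialOrder (Moment I d) where
  le m m' := m.time ≤ m'.time ∧ ∀ i < m.time, m.path i = m'.path i
  le_refl m := ⟨le_rfl, fun _ _ => rfl⟩
  le_trans m₁ m₂ m₃ h₁ h₂ :=
    ⟨h₁.1.trans h₂.1, fun i hi => (h₁.2 i hi).trans (h₂.2 i (hi.trans_le h₁.1))⟩
  le_antisymm m m' h h' := by
    have ht := le_antisymm h.1 h'.1
    refine Moment.ext ht (funext fun i => ?_)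
    rcases lt_or_ge i m.time with hi | hi
    · exact h.2 i hi
    · rw [m.path_eq i hi, m'.path_eq i (ht ▸ hi)]

theorem time_lt {m m' : Moment I d} (h : m < m') : m.time < m'.time := by
  refine h.le.1.lt_of_ne fun ht => h.ne (le_antisymm h.le ⟨ht.ge, fun i hi => ?_⟩)
  exact (h.le.2 i (ht ▸ hi)).symm

theorem le_total_of_le {m m₁ m₂ : Moment I d} (h₁ : m₁ ≤ m) (h₂ : m₂ ≤ m) :
    m₁ ≤ m₂ ∨ m₂ ≤ m₁ := by
  rcases le_total m₁.time m₂.time with h | h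
  · exact .inl ⟨h, fun i hi => (h₁.2 i hi).trans (h₂.2 i (hi.trans_le h)).symm⟩
  · exact .inr ⟨h, fun i hi => (h₂.2 i hi).trans (h₁.2 i (hi.trans_le h)).symm⟩

/-- The initial segment of `m` of length `i`. -/
def restrict (m : Moment I d) (i : I) : Moment I d where
  time := min i m.time
  path k := if k < i then m.path k else d
  path_eq k hk := by
    split_ifs with h
    · exact m.path_eq k ((min_le_iff.1 hk).resolve_left h.not_ge)
    · rfl

theorem restrict_le (m : Moment I d) (i : I) : m.restrict i ≤ m :=
  ⟨min_le_right _ _, fun _ hk => if_pos (hk.trans_le (min_le_left _ _))⟩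

/-- The continuation of `m` up to time `j` with the constant value `w`. -/
def extend (m : Moment I d) (w : W) {j : I} (hj : m.time < j) : Moment I d where
  time := j
  path k := if k < m.time then m.path k else if k < j then w else d
  path_eq k hk := by
    rw [if_neg (hj.le.trans hk).not_gt, if_neg hk.not_gt]

theorem lt_extend (m : Moment I d) (w : W) {j : I} (hj : m.time < j) : m < m.extend w hj := by
  refine lt_of_le_of_ne ⟨hj.le, fun i hi => (if_pos hi).symm⟩ fun h => hj.ne ?_
  exact congrArg Moment.time h

theorem extend_path (m : Moment I d) (w : W) {j : I} (hj : m.time < j) :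
    (m.extend w hj).path m.time = w := by
  simp [extend, hj]

open Classical in
/-- The value at time `m.time` of the sequence that the history `h` follows; it says in which
direction `h` leaves the moment `m`. -/
noncomputable def dir (m : Moment I d) (h : Hist (Moment I d)) : W :=
  if hm : ∃ m' ∈ h.1, m < m' then hm.choose.path m.time else d

theorem dir_eq {m m' : Moment I d} {h : Hist (Moment I d)} (hm' : m' ∈ h.1) (hlt : m < m') :
    m.dir h = m'.path m.time := by
  have hex : ∃ m' ∈ h.1, m < m' := ⟨m', hm', hlt⟩
  obtain ⟨hc, hc'⟩ := hex.choose_spec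
  rw [dir, dif_pos hex]
  rcases h.2.1.total hc hm' with hle | hle
  · exact hle.2 _ (time_lt hc')
  · exact (hle.2 _ (time_lt hlt)).symm

variable [NoMaxOrder I]

theorem exists_dir_eq (m : Moment I d) (w : W) : ∃ h ∈ histThrough m, m.dir h = w := by
  obtain ⟨j, hj⟩ := exists_gt m.time
  obtain ⟨h, hm, hm'⟩ := exists_hist_of_le (m.lt_extend w hj).le
  exact ⟨h, hm, by rw [dir_eq hm' (m.lt_extend w hj), extend_path]⟩

end Moment

end SequenceTree

/-! ### The canonical model -/

section Canonical

variable {CS : Set (Form Ag)}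

/-- A mature successor of `Γ`, as provided by `World.exists_mature`. -/
noncomputable def World.mature (Γ : World CS) : World CS := Γ.exists_mature.choose

theorem World.acc_mature (Γ : World CS) : Γ.Acc know Γ.mature := Γ.exists_mature.choose_spec.1

theorem World.box_pres_mem_mature {Γ : World CS} {t : Pol} (h : pres t ∈ Γ) :
    box (pres t) ∈ Γ.mature := Γ.exists_mature.choose_spec.2.1 t h

theorem World.box_pres_mem_mature_of_acc {Γ Θ : World CS} (hΘ : Γ.mature.Acc box Θ) {t : Pol}
    (h : pres t ∈ Θ) : box (pres t) ∈ Γ.mature := Γ.exists_mature.choose_spec.2.2 Θ hΘ t h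

open Classical in
/-- `Δ` if this world lies in the `□`-class of `Γ`, and `Γ` otherwise. -/
noncomputable def World.clamp (Γ Δ : World CS) : World CS := if Γ.Acc box Δ then Δ else Γ

theorem World.acc_clamp (Γ Δ : World CS) : Γ.Acc box (Γ.clamp Δ) := by
  rw [World.clamp]
  split_ifs with h
  exacts [h, Γ.acc_refl provable_s4_box]

theorem World.clamp_eq {Γ Δ : World CS} (h : Γ.Acc box Δ) : Γ.clamp Δ = Δ := if_pos h

/-- Time of the canonical model: a first instant for the root, a second one for the base moments,
and then a copy of `ℤ`, which has no first element. -/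
abbrev Time : Type := WithBot (WithBot ℤ)

namespace Canonical

variable (Γ₀ : World CS)

/-- Moments of the canonical model. -/
abbrev Tree : Type u := Moment Time Γ₀

variable {Γ₀}

/-- The world whose `□`-class is attached to a moment. The root carries no class that matters; a
base moment has the class of the first entry `Γ` of its path; all later moments have the class of
the mature successor of the second entry, which is read as a world in the class of `Γ`. -/
noncomputable def rep (m : Tree Γ₀) : World CS :=
  match m.time with
  | ⊥ => Γ₀
  | (⊥ : WithBot ℤ) => m.path ⊥
  | ((_ : ℤ) : WithBot ℤ) => ((m.path ⊥).clamp (m.path (⊥ : WithBot ℤ))).mature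

/-- The root precedes all other moments; it is the only moment where truth and membership in
worlds are unrelated. -/
def IsRoot (m : Tree Γ₀) : Prop := m.time = ⊥

/-- The world attached to a moment-history pair. -/
noncomputable def lab (m : Tree Γ₀) (h : Hist (Tree Γ₀)) : World CS := (rep m).clamp (m.dir h)

theorem rep_base {m : Tree Γ₀} (h : m.time = (⊥ : WithBot ℤ)) : rep m = m.path ⊥ := by
  rw [rep, h]

theorem rep_late {m : Tree Γ₀} {k : ℤ} (h : m.time = (k : WithBot ℤ)) :
    rep m = ((m.path ⊥).clamp (m.path (⊥ : WithBot ℤ))).mature := by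
  rw [rep, h]

theorem time_cases (i : Time) : i = ⊥ ∨ i = (⊥ : WithBot ℤ) ∨ ∃ k : ℤ, i = (k : WithBot ℤ) := by
  rcases i with _ | _ | k
  exacts [.inl rfl, .inr (.inl rfl), .inr (.inr ⟨k, rfl⟩)]

theorem IsRoot.le {m : Tree Γ₀} (h : IsRoot m) (m' : Tree Γ₀) : m ≤ m' := by
  rw [IsRoot] at h
  refine ⟨h ▸ bot_le, fun i hi => ?_⟩
  rw [h] at hi
  exact absurd hi not_lt_bot

theorem not_isRoot_of_lt {m m' : Tree Γ₀} (h : m < m') : ¬ IsRoot m' :=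
  fun h' => (h'.le m).not_gt h

theorem acc_lab (m : Tree Γ₀) (h : Hist (Tree Γ₀)) : (rep m).Acc box (lab m h) :=
  World.acc_clamp _ _

theorem exists_lab_eq (m : Tree Γ₀) {Δ : World CS} (hΔ : (rep m).Acc box Δ) :
    ∃ h ∈ histThrough m, lab m h = Δ := by
  obtain ⟨h, hh, hd⟩ := m.exists_dir_eq Δ
  exact ⟨h, hh, by rw [lab, hd, World.clamp_eq hΔ]⟩

/-- Undivided histories get the same direction. -/
theorem dir_eq_of_undivided {m m' : Tree Γ₀} {h h' : Hist (Tree Γ₀)} (hlt : m < m')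
    (hm : m' ∈ h.1) (hm' : m' ∈ h'.1) : m.dir h = m.dir h' := by
  rw [Moment.dir_eq hm hlt, Moment.dir_eq hm' hlt]

theorem box_mem_rep_iff {m : Tree Γ₀} {A : Form Ag} :
    box A ∈ rep m ↔ ∀ h ∈ histThrough m, A ∈ lab m h := by
  refine ⟨fun hA h _ => acc_lab m h A hA, fun hall => ?_⟩
  by_contra hn
  obtain ⟨Δ, hΔ, hA⟩ := isNormal_box.exists_acc hn
  obtain ⟨h, hh, rfl⟩ := exists_lab_eq m hΔ
  exact hA (hall h hh)

/-- The class of a moment above the root is that of the base moment in its past, or that of a mature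
successor of a world in the latter class. -/
theorem rep_cases_of_isRoot {m m' : Tree Γ₀} {h : Hist (Tree Γ₀)} (hm : IsRoot m) (hlt : m < m')
    (hm' : m' ∈ h.1) :
    rep m' = m.dir h ∨ ∃ Θ, (m.dir h).Acc box Θ ∧ rep m' = Θ.mature := by
  rw [Moment.dir_eq hm' hlt, show m.time = ⊥ from hm]
  rcases time_cases m'.time with ht | ht | ⟨k, ht⟩
  · exact absurd ht (not_isRoot_of_lt hlt)
  · exact .inl (rep_base ht)
  · exact .inr ⟨_, World.acc_clamp _ _, rep_late ht⟩

/-- Moving on from a moment other than the root, one either leaves a base moment for the mature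
successor of the world just realized, or stays in the class of a mature world. -/
theorem rep_cases_of_not_isRoot {m m' : Tree Γ₀} {h : Hist (Tree Γ₀)} (hm : ¬ IsRoot m)
    (hlt : m < m') (hm' : m' ∈ h.1) :
    rep m' = (lab m h).mature ∨ (rep m' = rep m ∧ ∃ Θ : World CS, rep m = Θ.mature) := by
  have htime := Moment.time_lt hlt
  rcases time_cases m.time with ht | ht | ⟨k, ht⟩
  · exact absurd ht hm
  all_goals
    obtain ⟨k', ht'⟩ : ∃ k' : ℤ, m'.time = (k' : WithBot ℤ) := by
      rcases time_cases m'.time with ht' | ht' | ht'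
      · exact absurd (ht' ▸ htime) not_lt_bot
      · rw [ht, ht'] at htime
        simp at htime
      · exact ht'
  · left
    rw [lab, Moment.dir_eq hm' hlt, ht, rep_base ht, rep_late ht', hlt.le.2 ⊥ (by simp [ht])]
  · right
    have h₁ := hlt.le.2 ⊥ (by simp [ht])
    have h₂ := hlt.le.2 (⊥ : WithBot ℤ) (by simp [ht])
    exact ⟨by rw [rep_late ht, rep_late ht', h₁, h₂], _, rep_late ht⟩

theorem acc_know_lab_right {Γ : World CS} {m : Tree Γ₀} {h : Hist (Tree Γ₀)}
    (hΓ : Γ.Acc know (rep m)) : Γ.Acc know (lab m h) := fun A hA =>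
  (lab m h).mp_ax (.a7 (.axT A)) (((acc_lab m h).know_mem_iff A).1
    (hΓ _ (Γ.mp_ax (.a7 (.ax4 A)) hA)))

theorem acc_know_of_lt {m m' : Tree Γ₀} (hm : ¬ IsRoot m) (hlt : m < m') :
    (rep m).Acc know (rep m') := by
  obtain ⟨h, -, hm'⟩ := exists_hist_of_le hlt.le
  rcases rep_cases_of_not_isRoot hm hlt hm' with h' | ⟨h', -⟩ <;> rw [h']
  · exact (acc_know_lab_right ((rep m).acc_refl provable_s4_know)).trans provable_s4_know
      (lab m h).acc_mature
  · exact (rep m).acc_refl provable_s4_know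

/-- A proof that is presented to a history is settled at all later moments of the history. -/
theorem box_pres_mem_rep_of_lt {m m' : Tree Γ₀} {h : Hist (Tree Γ₀)} (hm : ¬ IsRoot m)
    (hlt : m < m') (hm' : m' ∈ h.1) {t : Pol} (ht : pres t ∈ lab m h) :
    box (pres t) ∈ rep m' := by
  rcases rep_cases_of_not_isRoot hm hlt hm' with h' | ⟨h', Θ, hΘ⟩ <;> rw [h']
  · exact World.box_pres_mem_mature ht
  · have hacc := acc_lab m h
    rw [hΘ] at hacc ⊢
    exact World.box_pres_mem_mature_of_acc hacc ht

theorem box_pres_mem_rep_of_isRoot {m m' : Tree Γ₀} {h : Hist (Tree Γ₀)} (hm : IsRoot m)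
    (hlt : m < m') (hm' : m' ∈ h.1) {t : Pol} (ht : box (pres t) ∈ m.dir h) :
    box (pres t) ∈ rep m' := by
  rcases rep_cases_of_isRoot hm hlt hm' with h' | ⟨Θ, hΘ, h'⟩ <;> rw [h']
  · exact ht
  · exact World.box_pres_mem_mature (hΘ _ ht)

variable (Γ₀) in
/-- Every world is attached to a base moment. -/
theorem exists_rep_eq (Δ : World CS) : ∃ m : Tree Γ₀, ¬ IsRoot m ∧ rep m = Δ := by
  refine ⟨⟨(⊥ : WithBot ℤ), fun i => if i = ⊥ then Δ else Γ₀, fun i hi => ?_⟩, ?_, ?_⟩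
  · rw [if_neg]
    rintro rfl
    simp at hi
  · simp [IsRoot]
  · rw [rep_base rfl]
    simp

open Classical in
/-- The proofs presented at a moment-history pair. At the root these are the ones that are settled
at the base moment of the history, which makes them older than this moment. -/
def act (m : Tree Γ₀) (h : Hist (Tree Γ₀)) : Set Pol :=
  {t | if IsRoot m then box (pres t) ∈ m.dir h else pres t ∈ lab m h}

theorem mem_act_of_isRoot {m : Tree Γ₀} (hm : IsRoot m) {h : Hist (Tree Γ₀)} {t : Pol} :
    t ∈ act m h ↔ box (pres t) ∈ m.dir h := by
  simp [act, hm]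

theorem mem_act_of_not_isRoot {m : Tree Γ₀} (hm : ¬ IsRoot m) {h : Hist (Tree Γ₀)} {t : Pol} :
    t ∈ act m h ↔ pres t ∈ lab m h := by
  simp [act, hm]

theorem box_pres_mem_rep_iff {m : Tree Γ₀} (hm : ¬ IsRoot m) {t : Pol} :
    box (pres t) ∈ rep m ↔ t ∈ ⋂ h ∈ histThrough m, act m h := by
  simp only [box_mem_rep_iff, Set.mem_iInter, mem_act_of_not_isRoot hm]

/-- A settled proof was presented before: at the root in the case of a base moment, and at an
earlier moment of the same class in the case of a later one. -/
theorem exists_lt_mem_act {m : Tree Γ₀} (hm : ¬ IsRoot m) {t : Pol} (ht : box (pres t) ∈ rep m) :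
    ∃ m' < m, ∃ h ∈ histThrough m, t ∈ act m' h := by
  obtain ⟨h, hh, -⟩ := exists_hist_of_le (le_refl m)
  rcases time_cases m.time with htm | htm | ⟨k, htm⟩
  · exact absurd htm hm
  · have hroot : IsRoot (m.restrict ⊥) := by simp [IsRoot, Moment.restrict]
    have hlt : m.restrict ⊥ < m :=
      lt_of_le_of_ne (m.restrict_le ⊥) fun he => hm (he ▸ hroot)
    refine ⟨_, hlt, h, hh, (mem_act_of_isRoot hroot).2 ?_⟩
    rwa [Moment.dir_eq hh hlt, show (m.restrict ⊥).time = ⊥ from hroot, ← rep_base htm]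
  · have htime : (m.restrict ((k - 1 : ℤ) : WithBot ℤ)).time = ((k - 1 : ℤ) : WithBot ℤ) := by
      refine min_eq_left ?_
      rw [htm]
      norm_cast
      omega
    have hlt : m.restrict ((k - 1 : ℤ) : WithBot ℤ) < m := by
      refine lt_of_le_of_ne (m.restrict_le _) fun he => ?_
      have := (congrArg Moment.time he).symm.trans htime
      rw [htm] at this
      norm_cast at this
      omega
    have hroot : ¬ IsRoot (m.restrict ((k - 1 : ℤ) : WithBot ℤ)) := by
      rw [IsRoot, htime]
      simp
    refine ⟨_, hlt, h, hh, (mem_act_of_not_isRoot hroot).2 (acc_lab _ h _ ?_)⟩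
    have h₁ := hlt.le.2 ⊥ (by simp [htime])
    have h₂ := hlt.le.2 (⊥ : WithBot ℤ) (by simp [htime])
    rwa [rep_late htime, h₁, h₂, ← rep_late htm]

/-- The choice cell of the history `h` for the agent `j` at the moment `m`. -/
def stitCell (m : Tree Γ₀) (j : Ag) (h : Hist (Tree Γ₀)) : Set (Hist (Tree Γ₀)) :=
  {h' | h' ∈ histThrough m ∧ (lab m h).Acc (stit j) (lab m h')}

theorem mem_stitCell_self {m : Tree Γ₀} (j : Ag) {h : Hist (Tree Γ₀)} (hh : h ∈ histThrough m) :
    h ∈ stitCell m j h := ⟨hh, World.acc_refl (provable_s4_stit j) _⟩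

theorem stitCell_eq {m : Tree Γ₀} {j : Ag} {h h' : Hist (Tree Γ₀)} (hh : h' ∈ stitCell m j h) :
    stitCell m j h' = stitCell m j h := by
  ext k
  exact and_congr_right fun _ => ⟨fun hk => hh.2.trans (provable_s4_stit j) hk,
    fun hk => (hh.2.symm (provable_s5_stit j)).trans (provable_s4_stit j) hk⟩

/-- The epistemic accessibility between moments. The root is accessible from itself only. -/
def acc (m m' : Tree Γ₀) : Prop := IsRoot m ∨ (¬ IsRoot m' ∧ (rep m).Acc know (rep m'))

theorem acc_refl (m : Tree Γ₀) : acc m m :=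
  or_iff_not_imp_left.2 fun hm => ⟨hm, (rep m).acc_refl provable_s4_know⟩

theorem acc_trans {m₁ m₂ m₃ : Tree Γ₀} (h₁ : acc m₁ m₂) (h₂ : acc m₂ m₃) : acc m₁ m₃ := by
  rcases h₁ with h₁ | ⟨hn, h₁⟩
  · exact .inl h₁
  · rcases h₂ with h₂ | ⟨hn', h₂⟩
    · exact absurd h₂ hn
    · exact .inr ⟨hn', h₁.trans provable_s4_know h₂⟩

/-- The evidence at a moment: `t:A` holds in the world attached to it, or in every world in the case
of the root. -/
def evidence (m : Tree Γ₀) (t : Pol) : Set (Form Ag) :=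
  {A | ∀ Γ : World CS, IsRoot m ∨ Γ = rep m → just t A ∈ Γ}

theorem evidence_mono {m m' : Tree Γ₀} (h : acc m m') (t : Pol) :
    evidence m t ⊆ evidence m' t := by
  rintro A hA Γ hΓ
  rcases h with h | ⟨hn, h⟩
  · exact hA Γ (.inl h)
  · obtain rfl := hΓ.resolve_left hn
    exact h _ ((rep m).know_just_mem (hA _ (.inr rfl)))

end Canonical

open Canonical

/-- The canonical model. The world `Γ₀`, in which no proof is settled, ensures that no proof is
presented on all histories through the root. -/
noncomputable def canonicalModel [Finite Ag] (Γ₀ : World CS) (hΓ₀ : ∀ t, box (pres t) ∉ Γ₀) :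
    Model Ag where
  Tree := Tree Γ₀
  tree_nonempty := ⟨(exists_rep_eq Γ₀ Γ₀).choose⟩
  Choice m j := {s | ∃ h ∈ histThrough m, s = stitCell m j h}
  Act := act
  R := acc
  Re := acc
  Ev := evidence
  V p := {q | atom p ∈ lab q.1 q.2}
  choice_sub m j s hs := by
    obtain ⟨h, -, rfl⟩ := hs
    exact fun h' hh' => hh'.1
  choice_nonempty m j s hs := by
    obtain ⟨h, hh, rfl⟩ := hs
    exact ⟨h, mem_stitCell_self j hh⟩
  choice_unique m j h hh := by
    refine ⟨_, ⟨⟨h, hh, rfl⟩, mem_stitCell_self j hh⟩, ?_⟩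
    rintro s ⟨⟨h', -, rfl⟩, hs⟩
    exact (stitCell_eq hs).symm
  R_refl := acc_refl
  R_trans _ _ _ := acc_trans
  Re_refl := acc_refl
  Re_trans _ _ _ := acc_trans
  R_sub_Re _ _ := id
  historical_connection m m₁ := by
    have hroot : IsRoot (m.restrict ⊥) := by simp [IsRoot, Moment.restrict]
    exact ⟨_, m.restrict_le ⊥, hroot.le m₁⟩
  no_backward_branching _ _ _ := Moment.le_total_of_le
  no_choice_undivided m m' j h hh h' hh' hlt hm hm' s hs := by
    obtain ⟨k, -, rfl⟩ := hs
    simp only [stitCell, Set.mem_ofPred_eq, lab, dir_eq_of_undivided hlt hm hm', hh, hh']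
  independence m f hf := by
    choose k hk hfk using hf
    obtain ⟨Δ, hΔ, hΔ'⟩ := (rep m).exists_acc_stit (fun j => lab m (k j))
      fun j => acc_lab m (k j)
    obtain ⟨h, hh, rfl⟩ := exists_lab_eq m hΔ
    refine ⟨h, Set.mem_iInter.2 fun j => ?_⟩
    rw [hfk j]
    exact ⟨hh, hΔ' j⟩
  evidence_mono t m m' h := evidence_mono h t
  evidence_app m s t A B hs ht Γ hΓ :=
    Γ.mp (Γ.mp_ax (.a4 s t A B) (hs Γ hΓ)) (ht Γ hΓ)
  evidence_sum m s t A hA Γ hΓ := by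
    have : just s A ∈ Γ ∨ just t A ∈ Γ := hA.imp (fun h => h Γ hΓ) fun h => h Γ hΓ
    refine Γ.mp_ax (.a6 s t A) ?_
    rwa [← World.boolEval_mem, boolEval_or, World.boolEval_mem, World.boolEval_mem]
  evidence_bang m t A hA Γ hΓ := (Γ.and_mem.1 (Γ.mp_ax (.a5 t A) (hA Γ hΓ))).1
  expansion m m' hlt h hh t ht := by
    rw [mem_act_of_not_isRoot (not_isRoot_of_lt hlt)]
    refine acc_lab m h _ ?_
    by_cases hm : IsRoot m'
    · exact box_pres_mem_rep_of_isRoot hm hlt hh ((mem_act_of_isRoot hm).1 ht)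
    · exact box_pres_mem_rep_of_lt hm hlt hh ((mem_act_of_not_isRoot hm).1 ht)
  no_new_proofs_guaranteed m t ht := by
    by_cases hm : IsRoot m
    · obtain ⟨h, hh, hd⟩ := m.exists_dir_eq Γ₀
      exact absurd (hd ▸ (mem_act_of_isRoot hm).1 (Set.mem_iInter₂.1 ht h hh)) (hΓ₀ t)
    · obtain ⟨m', hlt, h, hh, ht'⟩ := exists_lt_mem_act hm ((box_pres_mem_rep_iff hm).2 ht)
      exact Set.mem_iUnion₂.2 ⟨m', hlt, Set.mem_iUnion₂.2 ⟨h, hh, ht'⟩⟩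
  new_proof_divides m h hh h' hh' hex := by
    obtain ⟨m', hlt, hm, hm'⟩ := hex
    simp only [act, lab, dir_eq_of_undivided hlt hm hm']
  future_matters m m' hle := by
    by_cases hm : IsRoot m
    · exact .inl hm
    · rcases hle.eq_or_lt with rfl | hlt
      · exact acc_refl m
      · exact .inr ⟨not_isRoot_of_lt hlt, acc_know_of_lt hm hlt⟩
  transparency m m' hacc t ht := by
    rcases hacc with hm | ⟨hm', hacc⟩
    · obtain ⟨h, hh, hd⟩ := m.exists_dir_eq Γ₀
      exact absurd (hd ▸ (mem_act_of_isRoot hm).1 (Set.mem_iInter₂.1 ht h hh)) (hΓ₀ t)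
    · by_cases hm : IsRoot m
      · obtain ⟨h, hh, hd⟩ := m.exists_dir_eq Γ₀
        exact absurd (hd ▸ (mem_act_of_isRoot hm).1 (Set.mem_iInter₂.1 ht h hh)) (hΓ₀ t)
      · exact (box_pres_mem_rep_iff hm').1
          (hacc _ ((rep m).mp_ax (.a9 t) ((box_pres_mem_rep_iff hm).2 ht)))

section Truth

variable [Finite Ag] (Γ₀ : World CS) (hΓ₀ : ∀ t, box (pres t) ∉ Γ₀)

theorem canonicalModel_unirelational : (canonicalModel Γ₀ hΓ₀).Unirelational := fun _ _ => id

theorem canonicalModel_respectsCS : (canonicalModel Γ₀ hΓ₀).RespectsCS CS :=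
  fun _ _ _ hA Γ _ => Γ.mem_of_provable (.rcs hA)

theorem mem_cell_canonicalModel {m : Tree Γ₀} {j : Ag} {h h' : Hist (Tree Γ₀)}
    (hh : h ∈ histThrough m) :
    h' ∈ (canonicalModel Γ₀ hΓ₀).cell m j h ↔ h' ∈ stitCell m j h := by
  refine ⟨?_, fun hh' => ⟨_, ⟨h, hh, rfl⟩, mem_stitCell_self j hh, hh'⟩⟩
  rintro ⟨s, ⟨k, -, rfl⟩, h₁, h₂⟩
  rwa [stitCell_eq h₁]

/-- The truth lemma. -/
theorem sat_canonicalModel_iff (A : Form Ag) {m : Tree Γ₀} {h : Hist (Tree Γ₀)}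
    (hm : ¬ IsRoot m) (hh : h ∈ histThrough m) :
    (canonicalModel Γ₀ hΓ₀).Sat m h A ↔ A ∈ lab m h := by
  -- Satisfaction at all accessible moments amounts to knowledge.
  have hknow {A : Form Ag} (ih : ∀ {m : Tree Γ₀} {h : Hist (Tree Γ₀)}, ¬ IsRoot m →
      h ∈ histThrough m → ((canonicalModel Γ₀ hΓ₀).Sat m h A ↔ A ∈ lab m h))
      {m : Tree Γ₀} {h : Hist (Tree Γ₀)} (hm : ¬ IsRoot m) :
      (∀ m', acc m m' → ∀ h' ∈ histThrough m', (canonicalModel Γ₀ hΓ₀).Sat m' h' A) ↔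
        know A ∈ lab m h := by
    rw [← (acc_lab m h).know_mem_iff]
    refine ⟨fun hall => ?_, fun hA m' hacc h' hh' => ?_⟩
    · by_contra hn
      obtain ⟨Δ, hΔ, hA⟩ := isNormal_know.exists_acc hn
      obtain ⟨m', hm', rfl⟩ := exists_rep_eq Γ₀ Δ
      obtain ⟨h', hh', hlab⟩ := exists_lab_eq m' ((rep m').acc_refl provable_s4_box)
      exact hA (hlab ▸ (ih hm' hh').1 (hall m' (.inr ⟨hm', hΔ⟩) h' hh'))
    · obtain ⟨hm', hacc⟩ := hacc.resolve_left hm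
      exact (ih hm' hh').2 (acc_know_lab_right hacc A hA)
  induction A generalizing m h with
  | atom p => exact Iff.rfl
  | and A B ihA ihB => exact (and_congr (ihA hm hh) (ihB hm hh)).trans (World.and_mem _).symm
  | neg A ih => exact (not_congr (ih hm hh)).trans (World.neg_mem _).symm
  | stit j A ih =>
    refine ⟨fun hall => ?_, fun hA h' hh' => ?_⟩
    · by_contra hn
      obtain ⟨Δ, hΔ, hA⟩ := (isNormal_stit j).exists_acc hn
      obtain ⟨h', hh', rfl⟩ := exists_lab_eq m
        ((acc_lab m h).trans provable_s4_box hΔ.box_of_stit)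
      exact hA ((ih hm hh').1 (hall h' ((mem_cell_canonicalModel Γ₀ hΓ₀ hh).2 ⟨hh', hΔ⟩)))
    · obtain ⟨hh', hacc⟩ := (mem_cell_canonicalModel Γ₀ hΓ₀ hh).1 hh'
      exact (ih hm hh').2 (hacc A hA)
  | box A ih =>
    rw [← (acc_lab m h).mem_iff provable_s5_box, box_mem_rep_iff]
    exact forall₂_congr fun h' hh' => ih hm hh'
  | just t A ih =>
    refine (and_congr_right' (hknow ih hm (h := h))).trans ?_
    rw [← (acc_lab m h).just_mem_iff]
    refine ⟨fun hA => hA.1 _ (.inr rfl), fun hA => ⟨fun Γ hΓ => ?_, ?_⟩⟩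
    · exact (hΓ.resolve_left hm) ▸ hA
    · exact (lab m h).and_mem.1 ((lab m h).mp_ax (.a5 t A)
        (((acc_lab m h).just_mem_iff t A).1 hA)) |>.2
  | know A ih => exact hknow ih hm
  | pres t => exact mem_act_of_not_isRoot hm

end Truth

/-- The theory of the one-point model is a world in which no proof is settled. -/
theorem exists_world_no_box_pres (hCS : IsConstSpec CS) :
    ∃ Γ : World CS, ∀ t, box (pres t) ∉ Γ := by
  obtain ⟨h, hh, -⟩ := exists_hist_of_le (le_refl PUnit.unit.{u + 1})
  have hcons := (pointModel Ag).consistent_of_satisfies (CS := CS) hCS (fun _ _ _ _ => trivial)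
    (m := PUnit.unit) (h := h) hh (Γ := {A | (pointModel Ag).Sat PUnit.unit h A}) fun A => id
  obtain ⟨Γ, hΓ⟩ := exists_world hcons
  refine ⟨Γ, fun t => Γ.neg_mem.1 (hΓ _ fun hbox => ?_)⟩
  exact hbox h hh

theorem satisfiable_of_consistent [Finite Ag] (hCS : IsConstSpec CS) {Γ : Set (Form Ag)}
    (hΓ : ¬ Entails CS Γ bot) :
    ∃ M : Model Ag, M.Unirelational ∧ M.RespectsCS CS ∧ M.Satisfies Γ := by
  obtain ⟨Γ₀, hΓ₀⟩ := exists_world_no_box_pres hCS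
  obtain ⟨Δ, hΔ⟩ := exists_world hΓ
  obtain ⟨m, hm, rfl⟩ := exists_rep_eq Γ₀ Δ
  obtain ⟨h, hh, hlab⟩ := exists_lab_eq m ((rep m).acc_refl provable_s4_box)
  exact ⟨canonicalModel Γ₀ hΓ₀, canonicalModel_unirelational Γ₀ hΓ₀,
    canonicalModel_respectsCS Γ₀ hΓ₀, m, h, hh, fun A hA =>
      (sat_canonicalModel_iff Γ₀ hΓ₀ A hm hh).2 (hlab ▸ hΔ A hA)⟩

theorem consistent_iff_not_entails (hCS : IsConstSpec CS) {Γ : Set (Form Ag)} :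
    Consistent CS Γ ↔ ¬ Entails CS Γ bot := by
  obtain ⟨Γ₀, -⟩ := exists_world_no_box_pres hCS
  exact not_congr ⟨Inconsistent.entails,
    Entails.inconsistent (not_provable_bot_of_not_entails Γ₀.consistent)⟩

theorem isConstSpec_empty : IsConstSpec (∅ : Set (Form Ag)) where
  form _ h := h.elim
  tail _ _ _ _ _ h := h.elim

/-- A formula that is not provable in `Σ_∅` fails in a unirelational model. -/
theorem provable_of_validates [Finite Ag] {A : Form Ag}
    (hA : ∀ M : Model Ag, M.Unirelational → M.Validates A) : Provable ∅ A := by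
  by_contra hn
  have hcons : ¬ Entails (∅ : Set (Form Ag)) {neg A} bot := by
    intro h
    rw [← insert_empty_eq] at h
    obtain ⟨L, hL, h'⟩ := h.imp_of_insert
    obtain rfl : L = [] := List.eq_nil_iff_forall_not_mem.2 fun B hB => hL B hB
    refine hn (provable_of_boolEval [_] (by simpa using h') fun v => ?_)
    simp [boolEval_imp, boolEval_neg, boolEval_bot]
  obtain ⟨M, hM, -, m, h, hh, hsat⟩ := satisfiable_of_consistent isConstSpec_empty hcons
  exact hsat _ rfl (hA M hM m h hh)

end Canonical

end JStit

theorem theorem3 (Ag : Type u) [Finite Ag] :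
    (∀ CS : Set (JStit.Form Ag), JStit.IsConstSpec CS → ∀ Γ : Set (JStit.Form Ag),
      (JStit.Consistent CS Γ ↔
        ∃ M : JStit.Model Ag, M.RespectsCS CS ∧ M.Satisfies Γ) ∧
      (JStit.Consistent CS Γ ↔
        ∃ M : JStit.Model Ag, M.Unirelational ∧ M.RespectsCS CS ∧ M.Satisfies Γ)) ∧
    (∀ A : JStit.Form Ag,
      (JStit.Provable ∅ A ↔ ∀ M : JStit.Model Ag, M.Validates A) ∧
      (JStit.Provable ∅ A ↔ ∀ M : JStit.Model Ag, M.Unirelational → M.Validates A)) := by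
  refine ⟨fun CS hCS Γ => ?_, fun A => ?_⟩
  · rw [JStit.consistent_iff_not_entails hCS]
    have hsound (M : JStit.Model Ag) (hM : M.RespectsCS CS) (hΓ : M.Satisfies Γ) :
        ¬ JStit.Entails CS Γ JStit.Form.bot := by
      obtain ⟨m, h, hh, hsat⟩ := hΓ
      exact M.consistent_of_satisfies hCS hM hh hsat
    refine ⟨⟨fun h => ?_, fun ⟨M, hM, hΓ⟩ => hsound M hM hΓ⟩,
      JStit.satisfiable_of_consistent hCS, fun ⟨M, _, hM, hΓ⟩ => hsound M hM hΓ⟩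
    obtain ⟨M, -, hM⟩ := JStit.satisfiable_of_consistent hCS h
    exact ⟨M, hM⟩
  · have hsound (h : JStit.Provable ∅ A) (M : JStit.Model Ag) : M.Validates A :=
      M.validates_of_provable JStit.isConstSpec_empty (fun _ _ _ hB => hB.elim) h
    exact ⟨⟨hsound, fun h => JStit.provable_of_validates fun M _ => h M⟩,
      fun h M _ => hsound h M, JStit.provable_of_validates⟩
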